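/- Let $K$ be a field and let $0<a<b<c$ be integers with $\gcd(a,b,c)=1$. In the polynomial ring $S=K[x,y]$ with graded maximal ideal $\mathfrak m=(x,y)$ consider the monomials $u_1=x^c$, $u_2=x^by^a$, $u_3=x^ay^b$, $u_4=y^c$ and the ideal $I=(u_1,u_2,u_3,u_4)$. Let $F(I)=\bigoplus_{j\ge 0}I^j/\mathfrak m I^j$ be the fiber cone of $I$, and let $J$ be its defining ideal, that is, the kernel of the $K$-algebra homomorphism $K[z_1,z_2,z_3,z_4]\to F(I)$ with $z_i\mapsto u_i+\mathfrak m I\in I/\mathfrak m I$ for $i=1,\dots,4$. Let $\mu(J)$ be the minimal number of generators of $J$. Then the following conditions are equivalent: (a) $F(I)$ is Cohen–Macaulay; (b) $\mu(J)\le 3$; (c) $\mu(J)=3$. -/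

import Mathlib

noncomputable section

/-- The depth of a local ring `A`: the supremum of the lengths of the `A`-regular sequences
contained in the maximal ideal. -/
def localDepth (A : Type*) [CommRing A] [IsLocalRing A] : ℕ∞ :=
  ⨆ (rs : List A) (_ : (∀ r ∈ rs, r ∈ IsLocalRing.maximalIdeal A) ∧
    RingTheory.Sequence.IsRegular A rs), (rs.length : ℕ∞)

/-- A local ring is Cohen–Macaulay if it is Noetherian and its depth equals its Krull dimension. -/
def IsCohenMacaulayLocal (A : Type*) [CommRing A] [IsLocalRing A] : Prop :=
  IsNoetherianRing A ∧ ((localDepth A : ℕ∞) : WithBot ℕ∞) = ringKrullDim A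

/-- A ring is Cohen–Macaulay if it is Noetherian and all its localizations at maximal ideals
are Cohen–Macaulay local rings. -/
def IsCohenMacaulay (A : Type*) [CommRing A] : Prop :=
  IsNoetherianRing A ∧ ∀ (m : Ideal A) [m.IsMaximal],
    IsCohenMacaulayLocal (Localization.AtPrime m)

section FiberCone

variable {K : Type*} [Field K] {σ ι : Type*}

/-- The fiber cone `F(I) = R(I) / 𝔪 R(I)` of an ideal `I` of a polynomial ring, where
`R(I) = ⨁ I ^ j t ^ j` is the Rees algebra and `𝔪` is the ideal generated by the variables. -/
abbrev FiberCone (I : Ideal (MvPolynomial σ K)) : Type _ :=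
  reesAlgebra I ⧸ (MvPolynomial.idealOfVars σ K).map
    (algebraMap (MvPolynomial σ K) (reesAlgebra I))

/-- The class `u + 𝔪 I` in the degree one component of `F(I)` of an element `u` of `I`: the residue
class of the element `u t` of the Rees algebra. -/
def FiberCone.degreeOne (I : Ideal (MvPolynomial σ K)) (u : I) : FiberCone I :=
  Ideal.Quotient.mk _ ⟨Polynomial.monomial 1 (u : MvPolynomial σ K),
    reesAlgebra.monomial_mem.mpr (by simp)⟩

/-- For an ideal `I = (u i | i)`, the canonical `K`-algebra homomorphism `K[z i | i] → F(I)`,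
`z i ↦ u i + 𝔪 I`. -/
def fiberConeMap (u : ι → MvPolynomial σ K) :
    MvPolynomial ι K →ₐ[K] FiberCone (Ideal.span (Set.range u)) :=
  MvPolynomial.aeval fun i =>
    FiberCone.degreeOne (Ideal.span (Set.range u)) ⟨u i, Ideal.subset_span ⟨i, rfl⟩⟩

/-- The defining ideal `J` of the fiber cone of `I = (u i | i)`: the kernel of the canonical
map `K[z i | i] → F(I)`. -/
def fiberConeDefiningIdeal (u : ι → MvPolynomial σ K) : Ideal (MvPolynomial ι K) :=
  RingHom.ker (fiberConeMap u)

end FiberCone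

/-- The generators `x ^ c`, `x ^ b * y ^ a`, `x ^ a * y ^ b`, `y ^ c` in `K[x, y]`. -/
def symmetricGenerators (K : Type*) [Field K] (a b c : ℕ) : Fin 4 → MvPolynomial (Fin 2) K :=
  ![MvPolynomial.X 0 ^ c,
    MvPolynomial.X 0 ^ b * MvPolynomial.X 1 ^ a,
    MvPolynomial.X 0 ^ a * MvPolynomial.X 1 ^ b,
    MvPolynomial.X 1 ^ c]

/-- The symmetric monomial ideal `(x ^ c, x ^ b * y ^ a, x ^ a * y ^ b, y ^ c)` of `K[x, y]`. -/
def symmetricIdeal (K : Type*) [Field K] (a b c : ℕ) : Ideal (MvPolynomial (Fin 2) K) :=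
  Ideal.span (Set.range (symmetricGenerators K a b c))

end

/-! A monomial in `z₀, …, z₃` vanishes in the fiber cone exactly when its value is a proper multiple
of another product of equally many generators, and two monomials of the same degree with equal value
are identified. So `J` is governed by inequalities between exponents.

The common mechanism is `PlaneReduction`: two linear forms `p, q` and homogeneous `f₀, f₁, f₂` in
`J` such that modulo `(p, q)` the ideal `J` becomes `(x * y, x ^ k, y ^ k)`, generated by the images
of the `f i`. That ideal needs three generators, so `μ(J) ≥ 3`. If `μ(J) ≤ 3`, Cramer's rule and
graded Nakayama give `J = (f)` (`eq_span_of_spanFinrank_le`). If `F(I)` is Cohen–Macaulay, then `p,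
q`, which generate the maximal ideal of the origin up to radical, have vanishing first Koszul
homology there; hence elements of `J ∩ (p, q)` lie in `(p, q) J` up to a factor with nonzero
constant term, and Nakayama again gives `J = (f)` (`eq_span_of_isCohenMacaulay`).

It remains to find the reduction and to show that `J = (f)` implies Cohen–Macaulayness, by
exhibiting `1, s, …, s ^ (k - 1), t, …, t ^ (k - 1)` as a basis of `F(I)` over a polynomial ring in
two variables. For `c < a + b`, take `p, q = z₀, z₃` and `f = (z₁z₂, z₁ ^ k, z₂ ^ k)`. For `a + b <
c`, take `p, q = z₀ - z₂, z₃ - z₁` and `f = (z₀z₃, z₃ ^ i z₁ ^ l, z₀ ^ i z₂ ^ l)`. For `c = a + b`,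
`J` is the ideal of a projective monomial curve and the `f i` are binomials; here `J = (f)` forces
`b = a + 1`, where the basis is found directly. -/

open RingTheory.Sequence

/-! ### Depth, regular sequences and Koszul homology in length two -/

/-- An integral extension does not raise the Krull dimension. -/
theorem ringKrullDim_le_of_algebra_isIntegral (A F : Type*) [CommRing A] [CommRing F] [Algebra A F]
    [Algebra.IsIntegral A F] : ringKrullDim F ≤ ringKrullDim A :=
  Order.krullDim_le_of_strictMono (PrimeSpectrum.comap (algebraMap A F)) fun _ _ h ↦
    Ideal.IsIntegral.comap_lt_comap h

theorem isWeaklyRegular_pair_iff {A : Type*} [CommRing A] {a b : A} :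
    IsWeaklyRegular A [a, b] ↔ (∀ x, a * x = 0 → x = 0) ∧ ∀ x, a ∣ b * x → a ∣ x := by
  rw [isWeaklyRegular_cons_iff, isWeaklyRegular_singleton_iff]
  refine and_congr ?_ ?_
  · rw [isSMulRegular_iff_right_eq_zero_of_smul]; rfl
  · rw [isSMulRegular_quotient_iff_mem_of_smul_mem]
    simp [← Ideal.mem_span_singleton, ← Submodule.ideal_span_singleton_smul]

/-- Divisibility by `C a` means vanishing modulo `a`, and the reduction of `g` is still monic, hence
not a zero divisor. -/
theorem Polynomial.C_dvd_of_C_dvd_monic_mul {A : Type*} [CommRing A] {a : A} {g w : Polynomial A}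
    (hg : g.Monic) (h : C a ∣ g * w) : C a ∣ w := by
  have hm : ∀ v : Polynomial A, C a ∣ v ↔ v.map (Ideal.Quotient.mk (Ideal.span {a})) = 0 := by
    intro v
    rw [C_dvd_iff_dvd_coeff, Polynomial.ext_iff]
    simp [Ideal.Quotient.eq_zero_iff_mem, Ideal.mem_span_singleton]
  rw [hm] at h ⊢
  rw [Polynomial.map_mul] at h
  exact (hg.map _).isRegular.left (by simpa using h)

/-- Univariate polynomials in the two variables of `K[x, y]` form a weakly regular sequence. -/
theorem MvPolynomial.isWeaklyRegular_aeval_X {K : Type*} [Field K] {f g : Polynomial K}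
    (hf : f.Monic) (hg : g.Monic) :
    IsWeaklyRegular (MvPolynomial (Fin 2) K)
      [Polynomial.aeval (X 0 : MvPolynomial (Fin 2) K) f,
        Polynomial.aeval (X 1 : MvPolynomial (Fin 2) K) g] := by
  -- In `K[x][y]` the first polynomial becomes a constant and the second stays monic.
  set e := (Polynomial.Bivariate.equivMvPolynomial K).symm
  have h0 : e (Polynomial.aeval (X 0 : MvPolynomial (Fin 2) K) f) = Polynomial.C f := by
    rw [← Polynomial.aeval_algHom_apply, Polynomial.Bivariate.equivMvPolynomial_symm_X_0]
    change Polynomial.aeval (Polynomial.CAlgHom (A := Polynomial K) (R := K) Polynomial.X) f = _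
    rw [Polynomial.aeval_algHom_apply]
    simp
  have h1 : e (Polynomial.aeval (X 1 : MvPolynomial (Fin 2) K) g) = g.map Polynomial.C := by
    rw [← Polynomial.aeval_algHom_apply, Polynomial.Bivariate.equivMvPolynomial_symm_X_1,
      Polynomial.aeval_def, Polynomial.map]
    rfl
  rw [isWeaklyRegular_pair_iff]
  constructor
  · intro x hx
    have h := congrArg e hx
    rw [map_mul, h0, map_zero, mul_eq_zero, Polynomial.C_eq_zero] at h
    exact (map_eq_zero_iff e e.injective).mp (h.resolve_left hf.ne_zero)
  · intro x hx
    rw [← map_dvd_iff e, h0] at hx ⊢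
    rw [map_mul, h1] at hx
    exact Polynomial.C_dvd_of_C_dvd_monic_mul (hg.map _) hx

/-- A ring that is finite and free over a polynomial ring in two variables over a field is
Cohen–Macaulay. -/
theorem isCohenMacaulay_of_finite_of_free (K : Type*) [Field K] (F : Type*) [CommRing F]
    [Algebra (MvPolynomial (Fin 2) K) F] [Module.Finite (MvPolynomial (Fin 2) K) F]
    [Module.Free (MvPolynomial (Fin 2) K) F] : IsCohenMacaulay F := by
  have hN : IsNoetherianRing F := IsNoetherianRing.of_finite (MvPolynomial (Fin 2) K) F
  refine ⟨hN, fun m _ ↦ ?_⟩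
  have hNL : IsNoetherianRing (Localization.AtPrime m) :=
    IsLocalization.isNoetherianRing m.primeCompl _ hN
  refine ⟨hNL, le_antisymm ?_ ?_⟩
  -- Depth is at most dimension: dividing by a regular sequence lowers the dimension by its length.
  · have key : localDepth (Localization.AtPrime m) ≤
        (ringKrullDim (Localization.AtPrime m)).unbot ringKrullDim_ne_bot := by
      refine iSup₂_le fun rs hrs ↦ ?_
      have h := ringKrullDim_add_length_eq_ringKrullDim_of_isRegular rs hrs.2
      rw [WithBot.le_unbot_iff, ← h]
      have : Nontrivial (Localization.AtPrime m ⧸ Ideal.ofList rs) := by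
        refine Ideal.Quotient.nontrivial_iff.mpr fun h ↦ hrs.2.2 ?_
        simp [h]
      exact le_add_of_nonneg_left ringKrullDim_nonneg_of_nontrivial
    simpa using (WithBot.coe_le_coe.mpr key)
  · have hdim : ringKrullDim (Localization.AtPrime m) ≤ 2 := by
      rw [IsLocalization.AtPrime.ringKrullDim_eq_height m]
      refine (Ideal.height_le_ringKrullDim_of_ne_top Ideal.IsPrime.ne_top').trans ?_
      refine (ringKrullDim_le_of_algebra_isIntegral (MvPolynomial (Fin 2) K) F).trans ?_
      simp
    refine hdim.trans ?_
    -- The residue field at `n` is finite over `K`, so each coordinate satisfies a monic equation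
    -- there. The two resulting elements `f(x), g(y)` of `n` are a regular sequence that survives
    -- flat extension to `F` and localization at `m`.
    let n : Ideal (MvPolynomial (Fin 2) K) := m.comap (algebraMap _ F)
    have hn : n.IsMaximal := Ideal.isMaximal_comap_of_isIntegral_of_isMaximal m
    let _ := Ideal.Quotient.field n
    have hfin : Module.Finite K (MvPolynomial (Fin 2) K ⧸ n) :=
      finite_of_finite_type_of_isJacobsonRing _ _
    have hex : ∀ i : Fin 2, ∃ f : Polynomial K, f.Monic ∧
        Polynomial.aeval (MvPolynomial.X i : MvPolynomial (Fin 2) K) f ∈ n := by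
      intro i
      obtain ⟨f, hf, h⟩ := Algebra.IsIntegral.isIntegral (R := K)
        (Ideal.Quotient.mkₐ K n (MvPolynomial.X i))
      refine ⟨f, hf, Ideal.Quotient.eq_zero_iff_mem.mp ?_⟩
      rw [← Polynomial.aeval_def, Polynomial.aeval_algHom_apply] at h
      exact h
    obtain ⟨f, hf, hfn⟩ := hex 0
    obtain ⟨g, hg, hgn⟩ := hex 1
    have hreg := ((MvPolynomial.isWeaklyRegular_aeval_X hf hg).of_flat (S := F)
      ).isRegular_of_isLocalization_of_mem (Localization.AtPrime m) m
      (by simpa using ⟨hfn, hgn⟩)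
    have : (2 : ℕ∞) ≤ localDepth (Localization.AtPrime m) := by
      refine le_iSup₂_of_le _ ⟨?_, hreg⟩ (by simp)
      simp only [List.map_cons, List.map_nil, List.mem_cons, List.not_mem_nil, or_false]
      rintro r (rfl | rfl)
      · exact (IsLocalization.AtPrime.to_map_mem_maximal_iff _ m _).mpr hfn
      · exact (IsLocalization.AtPrime.to_map_mem_maximal_iff _ m _).mpr hgn
    exact WithBot.coe_le_coe.mpr this

theorem IsWeaklyRegular.pow_pair {L : Type*} [CommRing L] {a b : L} (h : IsWeaklyRegular L [a, b])
    (N : ℕ) : IsWeaklyRegular L [a ^ N, b ^ N] := by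
  rw [isWeaklyRegular_pair_iff] at h ⊢
  obtain ⟨ha, hb⟩ := h
  have ha' : ∀ n x, a ^ n * x = 0 → x = 0 := by
    intro n
    induction n with
    | zero => simp
    | succ n ih => exact fun x hx ↦ ih x (ha _ (by rw [← hx]; ring))
  refine ⟨ha' N, ?_⟩
  have hb' : ∀ n x, a ^ n ∣ b * x → a ^ n ∣ x := by
    intro n
    induction n with
    | zero => simp
    | succ n ih =>
      rintro x ⟨y, hy⟩
      obtain ⟨z, rfl⟩ := hb x ⟨a ^ n * y, by rw [hy]; ring⟩
      have h0 : b * z - a ^ n * y = 0 := ha _ (by linear_combination hy)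
      rw [pow_succ']
      exact mul_dvd_mul_left a (ih z ⟨y, sub_eq_zero.mp h0⟩)
  intro x hx
  suffices ∀ n, a ^ N ∣ b ^ n * x → a ^ N ∣ x from this N hx
  intro n
  induction n with
  | zero => simp
  | succ n ih => exact fun h ↦ ih (hb' N _ (by rwa [← mul_assoc, ← pow_succ']))

/-- If a power of each term of a regular sequence of length two lies in `(p, q)`, then the first
Koszul homology of `p, q` vanishes. -/
theorem exists_eq_mul_of_isWeaklyRegular {L : Type*} [CommRing L] {a b p q v w : L}
    (h : IsWeaklyRegular L [a, b]) (ha : ∃ N, a ^ N ∈ Ideal.span {p, q})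
    (hb : ∃ N, b ^ N ∈ Ideal.span {p, q}) (hvw : p * v + q * w = 0) :
    ∃ t, v = q * t ∧ w = -(p * t) := by
  obtain ⟨N, hN⟩ := ha
  obtain ⟨M, hM⟩ := hb
  have h' := IsWeaklyRegular.pow_pair h (N + M)
  rw [isWeaklyRegular_pair_iff] at h'
  obtain ⟨ha, hb⟩ := h'
  obtain ⟨a₁, a₂, haa⟩ := Ideal.mem_span_pair.mp
    ((pow_add a N M ▸ Ideal.mul_mem_right _ _ hN) : a ^ (N + M) ∈ Ideal.span {p, q})
  obtain ⟨b₁, b₂, hbb⟩ := Ideal.mem_span_pair.mp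
    ((pow_add b N M ▸ Ideal.mul_mem_left _ _ hM) : b ^ (N + M) ∈ Ideal.span {p, q})
  generalize a ^ (N + M) = a at *
  generalize b ^ (N + M) = b at *
  have hann : ∀ x, p * x = 0 → q * x = 0 → x = 0 := fun x h1 h2 ↦
    ha x (by rw [← haa]; linear_combination a₁ * h1 + a₂ * h2)
  -- With `a = a₁p + a₂q`, the syzygy gives `a v = q τ` and `a w = -p τ` for `τ = a₂v - a₁w`, and
  -- similarly for `b`. Comparing the two shows that `a` divides `b τ`, hence `τ`, and `a` can be
  -- cancelled.
  have h0 : b * (a₂ * v - a₁ * w) - a * (b₂ * v - b₁ * w) = 0 := by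
    apply hann
    · rw [← haa, ← hbb]; linear_combination (b₁ * a₂ * p - a₁ * b₂ * p) * hvw
    · rw [← haa, ← hbb]; linear_combination (a₂ * b₁ - a₁ * b₂) * q * hvw
  obtain ⟨t, ht⟩ := hb (a₂ * v - a₁ * w) ⟨b₂ * v - b₁ * w, sub_eq_zero.mp h0⟩
  refine ⟨t, sub_eq_zero.mp (ha _ ?_), ?_⟩
  · rw [← haa] at ht ⊢; linear_combination a₁ * hvw + q * ht
  · refine eq_neg_of_add_eq_zero_left (ha _ ?_)
    rw [← haa] at ht ⊢; linear_combination a₂ * hvw - p * ht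

theorem IsCohenMacaulayLocal.exists_isWeaklyRegular_pair {L : Type*} [CommRing L] [IsLocalRing L]
    (h : IsCohenMacaulayLocal L) (hdim : 2 ≤ ringKrullDim L) :
    ∃ a ∈ IsLocalRing.maximalIdeal L, ∃ b ∈ IsLocalRing.maximalIdeal L,
      IsWeaklyRegular L [a, b] := by
  rw [← h.2] at hdim
  have h2 : (2 : ℕ∞) ≤ localDepth L := WithBot.coe_le_coe.mp hdim
  have h1 : (1 : ℕ∞) < localDepth L := lt_of_lt_of_le (by norm_num) h2
  obtain ⟨rs, hrs⟩ := lt_iSup_iff.mp h1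
  obtain ⟨⟨hmem, hreg⟩, hlen⟩ := lt_iSup_iff.mp hrs
  match rs, hlen with
  | a :: b :: rs, _ =>
    refine ⟨a, hmem a (by simp), b, hmem b (by simp), ?_⟩
    have := hreg.1
    simp only [isWeaklyRegular_cons_iff] at this ⊢
    exact ⟨this.1, this.2.1, IsWeaklyRegular.nil _ _⟩
  | [], h => simp at h
  | [a], h => simp at h

/-- Depth two provides a regular pair in the localization, whose terms have powers in `(p, q)`, so
the Koszul homology vanishes there; `s` clears denominators. -/
theorem IsCohenMacaulayLocal.exists_mul_eq {F : Type*} [CommRing F] {m : Ideal F} [m.IsPrime]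
    (h : IsCohenMacaulayLocal (Localization.AtPrime m)) (hdim : 2 ≤ m.height) {p q v w : F}
    (hpq : ∀ x ∈ m, ∃ N, x ^ N ∈ Ideal.span {p, q}) (hvw : p * v + q * w = 0) :
    ∃ s ∉ m, ∃ t, s * v = q * t ∧ s * w = -(p * t) := by
  have hd : 2 ≤ ringKrullDim (Localization.AtPrime m) := by
    rw [IsLocalization.AtPrime.ringKrullDim_eq_height m]
    exact WithBot.coe_le_coe.mpr hdim
  obtain ⟨a, ha, b, hb, hab⟩ := h.exists_isWeaklyRegular_pair hd
  set φ := algebraMap F (Localization.AtPrime m)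
  have key : ∀ c ∈ IsLocalRing.maximalIdeal (Localization.AtPrime m),
      ∃ N, c ^ N ∈ Ideal.span {φ p, φ q} := by
    intro c hc
    obtain ⟨x, s, rfl⟩ := IsLocalization.exists_mk'_eq m.primeCompl c
    have hx : x ∈ m := (IsLocalization.AtPrime.mk'_mem_maximal_iff _ m x s).mp hc
    obtain ⟨N, hN⟩ := hpq x hx
    refine ⟨N, ?_⟩
    rw [← IsLocalization.mk'_pow, IsLocalization.mk'_eq_mul_mk'_one, ← Set.image_pair,
      ← Ideal.map_span]
    exact Ideal.mul_mem_right _ _ (Ideal.mem_map_of_mem _ hN)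
  obtain ⟨t, hv, hw⟩ := exists_eq_mul_of_isWeaklyRegular hab (key a ha) (key b hb)
    (v := φ v) (w := φ w) (by simp only [← map_mul, ← map_add, hvw, map_zero])
  obtain ⟨y, s, rfl⟩ := IsLocalization.exists_mk'_eq m.primeCompl t
  have hs := IsLocalization.mk'_spec (Localization.AtPrime m) y s
  have h1 : φ (s * v) = φ (q * y) := by
    rw [map_mul, map_mul, hv, ← hs]; ring
  have h2 : φ (s * w) = φ (-(p * y)) := by
    rw [map_mul, map_neg, map_mul, hw, ← hs]; ring
  obtain ⟨c, hc⟩ := (IsLocalization.eq_iff_exists m.primeCompl _).mp h1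
  obtain ⟨d, hd⟩ := (IsLocalization.eq_iff_exists m.primeCompl _).mp h2
  refine ⟨(c * d * s : m.primeCompl), (c * d * s : m.primeCompl).2, c * d * y, ?_, ?_⟩
  · push_cast; linear_combination d * hc
  · push_cast; linear_combination c * hd

open MvPolynomial

/-! ### The defining ideal of a fiber cone, degree by degree -/

section FiberConeKernel

variable {K : Type*} [Field K] {σ ι : Type*}

/-- The `K`-algebra homomorphism `K[z i | i] → R(I)`, `z i ↦ u i t`, to the Rees algebra of
`I = (u i | i)`. -/
noncomputable def reesMap (u : ι → MvPolynomial σ K) :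
    MvPolynomial ι K →ₐ[K] reesAlgebra (Ideal.span (Set.range u)) :=
  aeval fun i ↦ ⟨Polynomial.monomial 1 (u i),
    reesAlgebra.monomial_mem.mpr (by rw [pow_one]; exact Ideal.subset_span ⟨i, rfl⟩)⟩

section Generators

variable (u : ι → MvPolynomial σ K)

theorem fiberConeMap_apply (f : MvPolynomial ι K) :
    fiberConeMap u f = Ideal.Quotient.mk _ (reesMap u f) := by
  have : fiberConeMap u = (Ideal.Quotient.mkₐ K _).comp (reesMap u) := by
    apply MvPolynomial.algHom_ext
    intro i
    simp [fiberConeMap, reesMap, FiberCone.degreeOne]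
  rw [this]
  rfl

theorem mem_fiberConeDefiningIdeal {f : MvPolynomial ι K} :
    f ∈ fiberConeDefiningIdeal u ↔ reesMap u f ∈ (idealOfVars σ K).map
      (algebraMap (MvPolynomial σ K) (reesAlgebra (Ideal.span (Set.range u)))) := by
  rw [fiberConeDefiningIdeal, RingHom.mem_ker]
  change fiberConeMap u f = 0 ↔ _
  rw [fiberConeMap_apply, Ideal.Quotient.eq_zero_iff_mem]

theorem coe_reesMap_monomial (m : ι →₀ ℕ) (c : K) :
    (reesMap u (monomial m c) : Polynomial (MvPolynomial σ K)) =
      Polynomial.monomial m.degree (aeval u (monomial m c)) := by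
  have h1 : (reesMap u (monomial m c) : Polynomial (MvPolynomial σ K)) =
      aeval (fun i ↦ Polynomial.monomial 1 (u i)) (monomial m c) := by
    change ((reesAlgebra (Ideal.span (Set.range u))).val.restrictScalars K).comp
      (reesMap u) (monomial m c) = _
    congr 1
    apply MvPolynomial.algHom_ext
    intro i
    simp [reesMap]
  have h2 : (m.prod fun i k ↦ (Polynomial.monomial 1 (u i)) ^ k) =
      Polynomial.monomial m.degree (m.prod fun i k ↦ u i ^ k) := by
    clear h1
    induction m using Finsupp.induction_linear with
    | zero => simp
    | add f g hf hg =>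
      rw [Finsupp.prod_add_index' (by simp) (by simp [pow_add]),
        Finsupp.prod_add_index' (by simp) (by simp [pow_add]), map_add,
        ← Polynomial.monomial_mul_monomial, hf, hg]
    | single i k => simp [Polynomial.monomial_pow]
  rw [h1, aeval_monomial, aeval_monomial, h2, ← Polynomial.C_mul_monomial]
  rfl

theorem coeff_reesMap (f : MvPolynomial ι K) (j : ℕ) :
    (reesMap u f : Polynomial (MvPolynomial σ K)).coeff j =
      aeval u (homogeneousComponent j f) := by
  induction f using MvPolynomial.induction_on' with
  | monomial m c =>
    rw [coe_reesMap_monomial, Polynomial.coeff_monomial,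
      homogeneousComponent_of_mem (isHomogeneous_monomial c rfl)]
    by_cases h : m.degree = j
    · simp [h]
    · simp [h, Ne.symm h]
  | add p q hp hq => simp [hp, hq]

theorem coe_reesMap_of_isHomogeneous {f : MvPolynomial ι K} {j : ℕ} (hf : f.IsHomogeneous j) :
    (reesMap u f : Polynomial (MvPolynomial σ K)) = Polynomial.monomial j (aeval u f) := by
  ext1 n
  rw [coeff_reesMap, homogeneousComponent_of_mem hf, Polynomial.coeff_monomial]
  by_cases h : j = n
  · simp [h]
  · simp [h, Ne.symm h]

/-- The extended ideal is generated in degree zero, hence graded with degree `j` part `m * I ^ j`.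
This is one inclusion; `mem_map_algebraMap_reesAlgebra` is the other. -/
theorem coeff_mem_of_mem_map_algebraMap_reesAlgebra {S : Type*} [CommRing S] {I m : Ideal S}
    {x : reesAlgebra I} (hx : x ∈ m.map (algebraMap S (reesAlgebra I))) (j : ℕ) :
    (x : Polynomial S).coeff j ∈ m * I ^ j := by
  induction hx using Submodule.span_induction generalizing j with
  | mem x hx =>
    obtain ⟨y, hy, rfl⟩ := hx
    change (Polynomial.C y).coeff j ∈ _
    rw [Polynomial.coeff_C]
    split_ifs with h
    · subst h; simpa using hy
    · exact zero_mem _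
  | zero => simp
  | add x y _ _ hx hy => simpa using Ideal.add_mem _ (hx j) (hy j)
  | smul a x _ hx =>
    rw [smul_eq_mul, MulMemClass.coe_mul, Polynomial.coeff_mul]
    refine Ideal.sum_mem _ fun ij hij ↦ ?_
    rw [← Finset.HasAntidiagonal.mem_antidiagonal.mp hij, pow_add, mul_left_comm]
    exact Ideal.mul_mem_mul (a.2 ij.1) (hx ij.2)

theorem mem_map_algebraMap_reesAlgebra {S : Type*} [CommRing S] {I m : Ideal S} {j : ℕ} {y : S}
    (hy : y ∈ m * I ^ j) (x : reesAlgebra I) (hx : (x : Polynomial S) = Polynomial.monomial j y) :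
    x ∈ m.map (algebraMap S (reesAlgebra I)) := by
  induction hy using Submodule.mul_induction_on' generalizing x with
  | mem_mul_mem a ha b hb =>
    have : x = algebraMap S (reesAlgebra I) a *
        ⟨Polynomial.monomial j b, reesAlgebra.monomial_mem.mpr hb⟩ := by
      apply Subtype.ext
      rw [hx]
      exact (Polynomial.C_mul_monomial).symm
    rw [this]
    exact Ideal.mul_mem_right _ _ (Ideal.mem_map_of_mem _ ha)
  | add a ha b hb iha ihb =>
    have ha' : Polynomial.monomial j a ∈ reesAlgebra I :=
      reesAlgebra.monomial_mem.mpr ((Ideal.mul_le_right : m * I ^ j ≤ I ^ j) ha)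
    have hb' : Polynomial.monomial j b ∈ reesAlgebra I :=
      reesAlgebra.monomial_mem.mpr ((Ideal.mul_le_right : m * I ^ j ≤ I ^ j) hb)
    have : x = ⟨_, ha'⟩ + ⟨_, hb'⟩ := Subtype.ext (hx.trans (map_add _ _ _))
    rw [this]
    exact Ideal.add_mem _ (iha _ rfl) (ihb _ rfl)

/-- A polynomial lies in the defining ideal of the fiber cone if and only if each of its
homogeneous components of degree `j` takes a value in `𝔪 I ^ j` at the generators of `I`. -/
theorem mem_fiberConeDefiningIdeal_iff {f : MvPolynomial ι K} :
    f ∈ fiberConeDefiningIdeal u ↔ ∀ j, aeval u (homogeneousComponent j f) ∈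
      idealOfVars σ K * Ideal.span (Set.range u) ^ j := by
  rw [mem_fiberConeDefiningIdeal]
  constructor
  · intro h j
    rw [← coeff_reesMap]
    exact coeff_mem_of_mem_map_algebraMap_reesAlgebra h j
  · intro h
    rw [← sum_homogeneousComponent f, map_sum]
    exact Ideal.sum_mem _ fun j _ ↦ mem_map_algebraMap_reesAlgebra (h j) _
      (coe_reesMap_of_isHomogeneous u (homogeneousComponent_isHomogeneous j f))

theorem homogeneousComponent_mem_fiberConeDefiningIdeal {f : MvPolynomial ι K}
    (hf : f ∈ fiberConeDefiningIdeal u) (j : ℕ) :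
    homogeneousComponent j f ∈ fiberConeDefiningIdeal u := by
  rw [mem_fiberConeDefiningIdeal_iff] at hf ⊢
  intro n
  rw [homogeneousComponent_of_mem (homogeneousComponent_isHomogeneous j f)]
  split_ifs with h
  · rw [h]; exact hf j
  · simp

theorem mem_fiberConeDefiningIdeal_of_isHomogeneous {f : MvPolynomial ι K} {j : ℕ}
    (hf : f.IsHomogeneous j)
    (h : aeval u f ∈ idealOfVars σ K * Ideal.span (Set.range u) ^ j) :
    f ∈ fiberConeDefiningIdeal u := by
  rw [mem_fiberConeDefiningIdeal_iff]
  intro n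
  rw [homogeneousComponent_of_mem hf]
  split_ifs with h'
  · rwa [h']
  · simp

/-- The elements of the Rees algebra whose class is in the image form a subalgebra `T`. It contains
degree zero, because a polynomial agrees with its constant term modulo the variables; then degree
one, by the generators; then every degree, by products. -/
theorem fiberConeMap_surjective : Function.Surjective (fiberConeMap u) := by
  set I := Ideal.span (Set.range u)
  set π := Ideal.Quotient.mkₐ K ((idealOfVars σ K).map
    (algebraMap (MvPolynomial σ K) (reesAlgebra I)))
  set T : Subalgebra K (reesAlgebra I) := (fiberConeMap u).range.comap π
  have hC : ∀ f, algebraMap (MvPolynomial σ K) (reesAlgebra I) f ∈ T := by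
    intro f
    refine ⟨C (constantCoeff f), ?_⟩
    have h1 : f - C (constantCoeff f) ∈ idealOfVars σ K := by
      rw [← pow_one (idealOfVars σ K), mem_pow_idealOfVars_iff']
      intro d hd
      obtain rfl : d = 0 := (Finsupp.degree_eq_zero_iff d).mp (by simpa using hd)
      simp [constantCoeff_eq]
    have h2 : π (algebraMap _ _ (f - C (constantCoeff f))) = 0 :=
      Ideal.Quotient.eq_zero_iff_mem.mpr (Ideal.mem_map_of_mem _ h1)
    rw [map_sub, map_sub, sub_eq_zero] at h2
    change fiberConeMap u (C (constantCoeff f)) = π _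
    rw [h2]
    change _ = π (algebraMap _ _ (algebraMap K (MvPolynomial σ K) _))
    rw [← IsScalarTower.algebraMap_apply, AlgHom.commutes]
    exact AlgHom.commutes (fiberConeMap u) _
  have h1 : ∀ y ∈ I, ∀ x : reesAlgebra I, (x : Polynomial (MvPolynomial σ K)) =
      Polynomial.monomial 1 y → x ∈ T := by
    intro y hy
    induction hy using Submodule.span_induction with
    | mem y hy =>
      obtain ⟨i, rfl⟩ := hy
      intro x hx
      refine ⟨X i, ?_⟩
      change fiberConeMap u (X i) = _
      rw [fiberConeMap, aeval_X, FiberCone.degreeOne]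
      exact congrArg π (Subtype.ext hx.symm)
    | zero =>
      intro x hx
      obtain rfl : x = 0 := Subtype.ext (by simpa using hx)
      exact zero_mem _
    | add y z hy hz ihy ihz =>
      intro x hx
      have hy' : Polynomial.monomial 1 y ∈ reesAlgebra I :=
        reesAlgebra.monomial_mem.mpr ((pow_one I).symm ▸ hy)
      have hz' : Polynomial.monomial 1 z ∈ reesAlgebra I :=
        reesAlgebra.monomial_mem.mpr ((pow_one I).symm ▸ hz)
      have : x = ⟨_, hy'⟩ + ⟨_, hz'⟩ := Subtype.ext (hx.trans (map_add _ _ _))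
      rw [this]
      exact add_mem (ihy _ rfl) (ihz _ rfl)
    | smul a y hy ih =>
      intro x hx
      have hy' : Polynomial.monomial 1 y ∈ reesAlgebra I :=
        reesAlgebra.monomial_mem.mpr ((pow_one I).symm ▸ hy)
      have : x = algebraMap _ _ a * ⟨_, hy'⟩ :=
        Subtype.ext (hx.trans Polynomial.C_mul_monomial.symm)
      rw [this]
      exact mul_mem (hC a) (ih _ rfl)
  have hj : ∀ j, ∀ y ∈ I ^ j, ∀ x : reesAlgebra I, (x : Polynomial (MvPolynomial σ K)) =
      Polynomial.monomial j y → x ∈ T := by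
    intro j
    induction j with
    | zero =>
      intro y _ x hx
      have : x = algebraMap _ _ y := Subtype.ext hx
      rw [this]
      exact hC y
    | succ j ih =>
      intro y hy
      rw [pow_succ'] at hy
      induction hy using Submodule.mul_induction_on' with
      | mem_mul_mem a ha b hb =>
        intro x hx
        have ha' : Polynomial.monomial 1 a ∈ reesAlgebra I :=
          reesAlgebra.monomial_mem.mpr ((pow_one I).symm ▸ ha)
        have hb' : Polynomial.monomial j b ∈ reesAlgebra I := reesAlgebra.monomial_mem.mpr hb
        have : x = ⟨_, ha'⟩ * ⟨_, hb'⟩ := by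
          refine Subtype.ext (hx.trans (Eq.symm ?_))
          change Polynomial.monomial 1 a * Polynomial.monomial j b = _
          rw [Polynomial.monomial_mul_monomial, add_comm]
        rw [this]
        exact mul_mem (h1 a ha _ rfl) (ih b hb _ rfl)
      | add y hy z hz ihy ihz =>
        intro x hx
        rw [← pow_succ'] at hy hz
        have hy' : Polynomial.monomial (j + 1) y ∈ reesAlgebra I :=
          reesAlgebra.monomial_mem.mpr hy
        have hz' : Polynomial.monomial (j + 1) z ∈ reesAlgebra I :=
          reesAlgebra.monomial_mem.mpr hz
        have : x = ⟨_, hy'⟩ + ⟨_, hz'⟩ := Subtype.ext (hx.trans (map_add _ _ _))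
        rw [this]
        exact add_mem (ihy _ rfl) (ihz _ rfl)
  intro x
  obtain ⟨x, rfl⟩ := Ideal.Quotient.mk_surjective x
  have hx : x = ∑ j ∈ (x : Polynomial (MvPolynomial σ K)).support,
      ⟨Polynomial.monomial j ((x : Polynomial (MvPolynomial σ K)).coeff j),
        reesAlgebra.monomial_mem.mpr (x.2 j)⟩ := by
    apply Subtype.ext
    rw [AddSubmonoidClass.coe_finsetSum]
    exact Polynomial.as_sum_support _
  have : x ∈ T := by
    rw [hx]
    exact sum_mem fun j _ ↦ hj j _ (x.2 j) _ rfl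
  exact this

end Generators

section Monomials

variable {e : ι → σ →₀ ℕ} {u : ι → MvPolynomial σ K}

theorem aeval_monomials_monomial (hu : ∀ i, u i = monomial (e i) 1) (m : ι →₀ ℕ) (c : K) :
    aeval u (monomial m c) = monomial (Finsupp.linearCombination ℕ e m) c := by
  obtain rfl : u = fun i ↦ monomial (e i) 1 := funext hu
  rw [aeval_monomial, Finsupp.linearCombination_apply]
  simp only [monomial_pow, one_pow]
  rw [Finsupp.prod, Finsupp.sum, ← monomial_sum_one, algebraMap_eq, C_mul_monomial, mul_one]

theorem exists_le_of_mem_support_of_mem_pow (hu : ∀ i, u i = monomial (e i) 1) {j : ℕ}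
    {h : MvPolynomial σ K} (hh : h ∈ Ideal.span (Set.range u) ^ j) {μ : σ →₀ ℕ}
    (hμ : μ ∈ h.support) :
    ∃ m : ι →₀ ℕ, m.degree = j ∧ Finsupp.linearCombination ℕ e m ≤ μ := by
  classical
  induction j generalizing h μ with
  | zero => exact ⟨0, by simp⟩
  | succ j ih =>
    rw [pow_succ'] at hh
    induction hh using Submodule.mul_induction_on' generalizing μ with
    | mem_mul_mem a ha b hb =>
      obtain ⟨α, hα, β, hβ, rfl⟩ := Finset.mem_add.mp (support_mul a b hμ)
      obtain ⟨m, hm, hle⟩ := ih hb hβ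
      have hr : Set.range u = (fun s ↦ monomial s (1 : K)) '' Set.range e := by
        rw [← Set.range_comp]
        exact congrArg Set.range (funext hu)
      rw [hr] at ha
      obtain ⟨_, ⟨i, rfl⟩, hi⟩ := mem_ideal_span_monomial_image.mp ha α hα
      refine ⟨Finsupp.single i 1 + m, by simp [hm, add_comm], ?_⟩
      rw [map_add, Finsupp.linearCombination_single, one_smul]
      exact add_le_add hi hle
    | add a ha b hb iha ihb =>
      rcases Finset.mem_union.mp (support_add hμ) with h | h
      · exact iha h
      · exact ihb h

theorem exists_lt_of_mem_support_of_mem_mul_pow (hu : ∀ i, u i = monomial (e i) 1) {j : ℕ}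
    {h : MvPolynomial σ K} (hh : h ∈ idealOfVars σ K * Ideal.span (Set.range u) ^ j)
    {μ : σ →₀ ℕ} (hμ : μ ∈ h.support) :
    ∃ m : ι →₀ ℕ, m.degree = j ∧ Finsupp.linearCombination ℕ e m < μ := by
  classical
  induction hh using Submodule.mul_induction_on' generalizing μ with
  | mem_mul_mem a ha b hb =>
    obtain ⟨α, hα, β, hβ, rfl⟩ := Finset.mem_add.mp (support_mul a b hμ)
    obtain ⟨m, hm, hle⟩ := exists_le_of_mem_support_of_mem_pow hu hb hβ
    rw [← pow_one (idealOfVars σ K)] at ha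
    have hα0 : α ≠ 0 := by
      rintro rfl
      simpa using (mem_pow_idealOfVars_iff 1 a).mp ha 0 hα
    exact ⟨m, hm, lt_of_le_of_lt hle (lt_add_of_pos_left β (pos_iff_ne_zero.mpr hα0))⟩
  | add a ha b hb iha ihb =>
    rcases Finset.mem_union.mp (support_add hμ) with h | h
    · exact iha h
    · exact ihb h

/-- The value at the generators of the degree `j` component of an element of the defining ideal
only involves monomials that are proper multiples of products of `j` generators. -/
theorem coeff_aeval_homogeneousComponent_eq_zero (hu : ∀ i, u i = monomial (e i) 1)
    {f : MvPolynomial ι K} (hf : f ∈ fiberConeDefiningIdeal u) {j : ℕ} {μ : σ →₀ ℕ}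
    (hμ : ∀ m : ι →₀ ℕ, m.degree = j → ¬ Finsupp.linearCombination ℕ e m < μ) :
    coeff μ (aeval u (homogeneousComponent j f)) = 0 := by
  by_contra h
  obtain ⟨m, hm, hlt⟩ := exists_lt_of_mem_support_of_mem_mul_pow hu
    ((mem_fiberConeDefiningIdeal_iff u).mp hf j) (mem_support_iff.mpr h)
  exact hμ m hm hlt

/-- If the product of generators with exponent vector `m` is not divisible by any other product
of the same number of generators, then the monomial `z ^ m` does not occur in the elements of the
defining ideal. -/
theorem coeff_eq_zero_of_mem_fiberConeDefiningIdeal (hu : ∀ i, u i = monomial (e i) 1)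
    {f : MvPolynomial ι K} (hf : f ∈ fiberConeDefiningIdeal u) {m : ι →₀ ℕ}
    (hm : ∀ m' : ι →₀ ℕ, m'.degree = m.degree →
      Finsupp.linearCombination ℕ e m' ≤ Finsupp.linearCombination ℕ e m → m' = m) :
    coeff m f = 0 := by
  classical
  have h := coeff_aeval_homogeneousComponent_eq_zero hu hf (j := m.degree)
    (μ := Finsupp.linearCombination ℕ e m) (fun m' hm' hlt ↦ by
      rw [hm m' hm' hlt.le] at hlt; exact lt_irrefl _ hlt)
  -- No other exponent vector of this degree has the same value, so the coefficient of the value is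
  -- that of `z ^ m` itself.
  rw [(homogeneousComponent m.degree f).as_sum, map_sum, coeff_sum, Finset.sum_eq_single m] at h
  · rwa [aeval_monomials_monomial hu, coeff_monomial, if_pos rfl, coeff_homogeneousComponent,
      if_pos rfl] at h
  · intro m' hm' hne
    rw [aeval_monomials_monomial hu, coeff_monomial, if_neg]
    intro heq
    refine hne (hm m' ?_ heq.le)
    rw [mem_support_iff, coeff_homogeneousComponent] at hm'
    by_contra hcon
    exact hm' (if_neg hcon)
  · intro hm'
    rw [notMem_support_iff.mp hm']
    simp

end Monomials

end FiberConeKernel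

/-! ### Homogeneous components and generators -/

section HomogeneousComponents

variable {K σ : Type*} [Field K]

theorem homogeneousComponent_mul_of_isHomogeneous {p : MvPolynomial σ K} {m : ℕ}
    (hp : p.IsHomogeneous m) (g : MvPolynomial σ K) (d : ℕ) :
    homogeneousComponent d (p * g) = if m ≤ d then p * homogeneousComponent (d - m) g else 0 := by
  induction g using MvPolynomial.induction_on' with
  | monomial μ c =>
    have hμ := isHomogeneous_monomial (R := K) (d := μ) c rfl
    rw [homogeneousComponent_of_mem (hp.mul hμ), homogeneousComponent_of_mem hμ]
    split_ifs <;> first | rfl | omega | simp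
  | add a b ha hb =>
    rw [mul_add, map_add, ha, hb, map_add]
    split_ifs <;> ring

theorem homogeneousComponent_mem_span_range {ι : Type*} [Finite ι] {f : ι → MvPolynomial σ K}
    (hf : ∀ i, ∃ d, (f i).IsHomogeneous d) {g : MvPolynomial σ K}
    (hg : g ∈ Ideal.span (Set.range f)) (d : ℕ) :
    homogeneousComponent d g ∈ Ideal.span (Set.range f) := by
  have := Fintype.ofFinite ι
  obtain ⟨c, rfl⟩ := Ideal.mem_span_range_iff_exists_fun.mp hg
  rw [map_sum]
  refine Ideal.sum_mem _ fun i _ ↦ ?_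
  obtain ⟨n, hn⟩ := hf i
  rw [mul_comm, homogeneousComponent_mul_of_isHomogeneous hn]
  split_ifs
  · exact Ideal.mul_mem_right _ _ (Ideal.subset_span ⟨i, rfl⟩)
  · exact zero_mem _

theorem mem_idealOfVars_of_constantCoeff_eq_zero {h : MvPolynomial σ K}
    (hh : constantCoeff h = 0) : h ∈ idealOfVars σ K := by
  rw [← pow_one (idealOfVars σ K), mem_pow_idealOfVars_iff']
  intro d hd
  obtain rfl : d = 0 := (Finsupp.degree_eq_zero_iff d).mp (by simpa using hd)
  exact hh

/-- At a monomial none of whose proper divisors occurs in `h`, multiplication acts through constant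
terms only. This lets coefficients detect minimal generators. -/
theorem coeff_mul_of_forall_lt {μ : σ →₀ ℕ} {h : MvPolynomial σ K}
    (hh : ∀ β < μ, coeff β h = 0) (c : MvPolynomial σ K) :
    coeff μ (c * h) = constantCoeff c * coeff μ h := by
  classical
  rw [coeff_mul, Finset.sum_eq_single (0, μ)]
  · rfl
  · rintro ⟨α, β⟩ hαβ hne
    have hs : α + β = μ := by simpa using hαβ
    have hα : α ≠ 0 := by
      rintro rfl
      exact hne (by rw [← hs, zero_add])
    rw [hh β (hs ▸ lt_add_of_pos_left β (pos_iff_ne_zero.mpr hα)), mul_zero]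
  · simp

theorem exists_span_range_eq_of_spanFinrank_le {R : Type*} [CommRing R] {J : Ideal R} (hJ : J.FG)
    {n : ℕ} (hn : J.spanFinrank ≤ n) : ∃ g : Fin n → R, Ideal.span (Set.range g) = J := by
  obtain ⟨s, hs, hsJ⟩ := Submodule.FG.exists_span_finset_card_eq_spanFinrank hJ
  -- The default `0` pads a minimal generating list to length `n` without changing its span.
  refine ⟨fun i ↦ s.toList.getD i 0, le_antisymm (Ideal.span_le.mpr ?_) ?_⟩
  · rintro _ ⟨i, rfl⟩
    by_cases h : (i : ℕ) < s.toList.length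
    · simp only [List.getD_eq_getElem _ _ h]
      rw [← hsJ]
      exact Submodule.subset_span (Finset.mem_toList.mp (List.getElem_mem h))
    · simp only [List.getD_eq_default _ _ (not_lt.mp h)]
      exact zero_mem _
  · rw [← hsJ]
    refine Submodule.span_mono fun x hx ↦ ?_
    obtain ⟨i, hi, rfl⟩ := List.getElem_of_mem (Finset.mem_toList.mpr hx)
    refine ⟨⟨i, ?_⟩, List.getD_eq_getElem _ _ hi⟩
    rw [Finset.length_toList] at hi
    omega

end HomogeneousComponents

/-! ### The ideal `(x * y, x ^ k, y ^ k)` of the plane -/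

section PlaneIdeal

variable {K : Type*} [Field K]

/-- The generators `x * y, x ^ k, y ^ k`. -/
noncomputable def planeGenerators (K : Type*) [Field K] (k : ℕ) : Fin 3 → MvPolynomial (Fin 2) K :=
  ![X 0 * X 1, X 0 ^ k, X 1 ^ k]

/-- The exponent vectors of `x * y, x ^ k, y ^ k`. -/
noncomputable def planeExponents (k : ℕ) : Fin 3 → Fin 2 →₀ ℕ :=
  ![Finsupp.single 0 1 + Finsupp.single 1 1, Finsupp.single 0 k, Finsupp.single 1 k]

theorem planeGenerators_eq_monomial (k : ℕ) (i : Fin 3) :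
    planeGenerators K k i = monomial (planeExponents k i) 1 := by
  fin_cases i <;> simp [planeGenerators, planeExponents, X, monomial_mul, monomial_pow]

theorem Finsupp.eq_single_of_fin_two {β : Fin 2 →₀ ℕ} {i j : Fin 2} (hij : i ≠ j)
    (hj : β j = 0) : β = Finsupp.single i (β i) := by
  ext l
  by_cases h : l = i
  · subst h; simp
  · obtain rfl : l = j := by omega
    simp [hj, hij]

/-- The monomials outside this ideal are exactly the pure powers of exponent less than `k`. -/
theorem mem_span_planeGenerators {k : ℕ} {h : MvPolynomial (Fin 2) K}
    (hh : ∀ i, ∀ r < k, coeff (Finsupp.single i r) h = 0) :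
    h ∈ Ideal.span (Set.range (planeGenerators K k)) := by
  have hr : Set.range (planeGenerators K k) =
      (fun s ↦ monomial s (1 : K)) '' Set.range (planeExponents k) := by
    rw [← Set.range_comp]
    exact congrArg Set.range (funext (planeGenerators_eq_monomial k))
  rw [hr, mem_ideal_span_monomial_image]
  intro μ hμ
  have hsingle : ∀ i j : Fin 2, i ≠ j → μ j = 0 → Finsupp.single i k ≤ μ := by
    intro i j hij hj
    have hμi := Finsupp.eq_single_of_fin_two hij hj
    rw [Finsupp.single_le_iff]
    by_contra hlt
    rw [hμi] at hμ
    exact mem_support_iff.mp hμ (hh i _ (not_le.mp hlt))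
  by_cases h1 : μ 1 = 0
  · exact ⟨_, ⟨1, rfl⟩, hsingle 0 1 (by decide) h1⟩
  by_cases h0 : μ 0 = 0
  · exact ⟨_, ⟨2, rfl⟩, hsingle 1 0 (by decide) h0⟩
  refine ⟨_, ⟨0, rfl⟩, fun i ↦ ?_⟩
  fin_cases i <;> simp [planeExponents] <;> omega

theorem exists_pow_mem_span_planeGenerators {h : MvPolynomial (Fin 2) K}
    (hh : constantCoeff h = 0) (k : ℕ) :
    ∃ N, h ^ N ∈ Ideal.span (Set.range (planeGenerators K k)) := by
  have : idealOfVars (Fin 2) K ≤ (Ideal.span (Set.range (planeGenerators K k))).radical := by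
    refine Ideal.span_le.mpr ?_
    rintro _ ⟨i, rfl⟩
    refine ⟨k, ?_⟩
    fin_cases i
    · exact Ideal.subset_span ⟨1, rfl⟩
    · exact Ideal.subset_span ⟨2, rfl⟩
  exact this (mem_idealOfVars_of_constantCoeff_eq_zero hh)

/-- Every proper divisor of `x * y`, `x ^ k` or `y ^ k` is a pure power of exponent less than `k`;
for `x * y` this needs `2 ≤ k`. -/
theorem coeff_mul_planeExponents {k : ℕ} (hk : 2 ≤ k) {h : MvPolynomial (Fin 2) K}
    (hh : ∀ i, ∀ r < k, coeff (Finsupp.single i r) h = 0) (c : MvPolynomial (Fin 2) K)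
    (i : Fin 3) :
    coeff (planeExponents k i) (c * h) = constantCoeff c * coeff (planeExponents k i) h := by
  refine coeff_mul_of_forall_lt (fun β hβ ↦ ?_) c
  have key : ∃ j : Fin 2, ∃ r < k, β = Finsupp.single j r := by
    have hle := hβ.le
    by_cases h1 : β 1 = 0
    · refine ⟨0, β 0, ?_, Finsupp.eq_single_of_fin_two (by decide) h1⟩
      fin_cases i
      · exact lt_of_le_of_lt (by simpa [planeExponents] using hle 0) hk
      · refine lt_of_le_of_ne (by simpa [planeExponents] using hle 0) fun h ↦ hβ.ne ?_
        rw [Finsupp.eq_single_of_fin_two (zero_ne_one) h1, h]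
        rfl
      · have : β 0 = 0 := by simpa [planeExponents] using hle 0
        omega
    · have h0 : β 0 = 0 := by
        by_contra h0
        fin_cases i
        · refine hβ.not_ge fun l ↦ ?_
          fin_cases l <;> simp [planeExponents] <;> omega
        · exact h1 (by simpa [planeExponents] using hle 1)
        · exact h0 (by simpa [planeExponents] using hle 0)
      refine ⟨1, β 1, ?_, Finsupp.eq_single_of_fin_two (by decide) h0⟩
      fin_cases i
      · exact lt_of_le_of_lt (by simpa [planeExponents] using hle 1) hk
      · have : β 1 = 0 := by simpa [planeExponents] using hle 1
        omega
      · refine lt_of_le_of_ne (by simpa [planeExponents] using hle 1) fun h ↦ hβ.ne ?_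
        rw [Finsupp.eq_single_of_fin_two (one_ne_zero) h0, h]
        rfl
  obtain ⟨j, r, hr, rfl⟩ := key
  exact hh j r hr

theorem planeExponents_injective {k : ℕ} (hk : 2 ≤ k) : Function.Injective (planeExponents k) := by
  intro i j h
  have h0 := DFunLike.congr_fun h 0
  have h1 := DFunLike.congr_fun h 1
  fin_cases i <;> fin_cases j <;> simp [planeExponents] at h0 h1 ⊢ <;> omega

theorem coeff_planeExponents_planeGenerators {k : ℕ} (hk : 2 ≤ k) (i j : Fin 3) :
    coeff (planeExponents k j) (planeGenerators K k i) = (1 : Matrix (Fin 3) (Fin 3) K) i j := by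
  rw [planeGenerators_eq_monomial, coeff_monomial, Matrix.one_apply]
  simp [(planeExponents_injective hk).eq_iff]

end PlaneIdeal

/-! ### Reduction to the plane: the criterion `J = (f)` -/

/-- A reduction of an ideal `J` of a polynomial ring modulo two linear forms `p, q`, through a
map `π` onto `K[x, y]` with kernel `(p, q)`, such that `π J = (x * y, x ^ k, y ^ k)`, the
generators being the images of homogeneous elements `f i` of `J`. -/
structure PlaneReduction {K σ : Type*} [Field K] (J : Ideal (MvPolynomial σ K)) (k : ℕ)
    (p q : MvPolynomial σ K) (π : MvPolynomial σ K →ₐ[K] MvPolynomial (Fin 2) K)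
    (f : Fin 3 → MvPolynomial σ K) : Prop where
  two_le : 2 ≤ k
  homogeneousComponent_mem : ∀ g ∈ J, ∀ d, homogeneousComponent d g ∈ J
  isHomogeneous_left : p.IsHomogeneous 1
  isHomogeneous_right : q.IsHomogeneous 1
  mem_span_pair : ∀ g, π g = 0 → g ∈ Ideal.span {p, q}
  surjective : Function.Surjective π
  constantCoeff_map : ∀ g, constantCoeff (π g) = constantCoeff g
  mem : ∀ i, f i ∈ J
  isHomogeneous : ∀ i, ∃ d, (f i).IsHomogeneous d
  map_generator : ∀ i, π (f i) = planeGenerators K k i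
  coeff_eq_zero : ∀ g ∈ J, ∀ i, ∀ r < k, coeff (Finsupp.single i r) (π g) = 0

namespace PlaneReduction

variable {K σ : Type*} [Field K] {J : Ideal (MvPolynomial σ K)} {k : ℕ}
  {p q : MvPolynomial σ K} {π : MvPolynomial σ K →ₐ[K] MvPolynomial (Fin 2) K}
  {f : Fin 3 → MvPolynomial σ K}

theorem exists_sub_mem (h : PlaneReduction J k p q π f) {y : MvPolynomial σ K}
    (hy : π y ∈ Ideal.span (Set.range (planeGenerators K k))) :
    ∃ g ∈ Ideal.span (Set.range f), y - g ∈ Ideal.span {p, q} := by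
  obtain ⟨c, hc⟩ := Ideal.mem_span_range_iff_exists_fun.mp hy
  choose b hb using fun i ↦ h.surjective (c i)
  refine ⟨∑ i, b i * f i, Ideal.sum_mem _ fun i _ ↦
    Ideal.mul_mem_left _ _ (Ideal.subset_span ⟨i, rfl⟩), h.mem_span_pair _ ?_⟩
  rw [map_sub, map_sum, ← hc, sub_eq_zero]
  simp [hb, h.map_generator]

theorem span_le (h : PlaneReduction J k p q π f) : Ideal.span (Set.range f) ≤ J :=
  Ideal.span_le.mpr (by rintro _ ⟨i, rfl⟩; exact h.mem i)

/-- Graded Nakayama, by induction on the degree `d` of `g`: the degree `d` part of `s * g` is the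
constant term of `s` times `g`, while `p * g₁ + q * g₂` contributes only components of `g₁, g₂` of
degree `d - 1`. -/
theorem eq_span_of_forall_exists (h : PlaneReduction J k p q π f)
    (hJ : ∀ g ∈ J, ∃ s, constantCoeff s ≠ 0 ∧ ∃ g₁ ∈ J, ∃ g₂ ∈ J,
      s * g - (p * g₁ + q * g₂) ∈ Ideal.span (Set.range f)) :
    J = Ideal.span (Set.range f) := by
  refine le_antisymm ?_ h.span_le
  have key : ∀ d, ∀ g ∈ J, g.IsHomogeneous d → g ∈ Ideal.span (Set.range f) := by
    intro d
    induction d using Nat.strong_induction_on with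
    | _ d ih =>
      intro g hg hd
      obtain ⟨s, hs, g₁, hg₁, g₂, hg₂, hmem⟩ := hJ g hg
      have hc := homogeneousComponent_mem_span_range h.isHomogeneous hmem d
      have hlin : ∀ l : MvPolynomial σ K, l.IsHomogeneous 1 → ∀ g' ∈ J,
          homogeneousComponent d (l * g') ∈ Ideal.span (Set.range f) := by
        intro l hl g' hg'
        rw [homogeneousComponent_mul_of_isHomogeneous hl]
        split_ifs with h1
        · exact Ideal.mul_mem_left _ _ (ih (d - 1) (by omega) _
            (h.homogeneousComponent_mem g' hg' _) (homogeneousComponent_isHomogeneous _ _))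
        · exact zero_mem _
      rw [map_sub, map_add, mul_comm s g, homogeneousComponent_mul_of_isHomogeneous hd,
        if_pos le_rfl, Nat.sub_self, homogeneousComponent_zero] at hc
      have hg' : g * C (coeff 0 s) ∈ Ideal.span (Set.range f) :=
        (Submodule.sub_mem_iff_left _ (Ideal.add_mem _
          (hlin p h.isHomogeneous_left g₁ hg₁) (hlin q h.isHomogeneous_right g₂ hg₂))).mp hc
      have hs' : coeff 0 s ≠ 0 := hs
      have := Ideal.mul_mem_right (C (coeff 0 s)⁻¹) _ hg'
      rwa [mul_assoc, ← C_mul, mul_inv_cancel₀ hs', C_1, mul_one] at this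
  intro g hg
  rw [← sum_homogeneousComponent g]
  exact Ideal.sum_mem _ fun d _ ↦ key d _ (h.homogeneousComponent_mem g hg d)
    (homogeneousComponent_isHomogeneous d g)

/-- Write `f = c g`, apply `π` and read off the coefficients at `x * y, x ^ k, y ^ k`: only the
constant terms of `c` matter, and the `f i` give the identity matrix. -/
theorem exists_matrix (h : PlaneReduction J k p q π f) {n : ℕ} {g : Fin n → MvPolynomial σ K}
    (hg : Ideal.span (Set.range g) = J) :
    ∃ (c : Matrix (Fin 3) (Fin n) (MvPolynomial σ K)) (θ : Matrix (Fin n) (Fin 3) K),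
      (∀ i, f i = ∑ j, c i j * g j) ∧ c.map constantCoeff * θ = 1 := by
  have hf : ∀ i, ∃ c : Fin n → MvPolynomial σ K, ∑ j, c j * g j = f i := fun i ↦
    Ideal.mem_span_range_iff_exists_fun.mp (hg ▸ h.mem i)
  choose c hc using hf
  refine ⟨c, fun j l ↦ coeff (planeExponents k l) (π (g j)), fun i ↦ (hc i).symm, ?_⟩
  ext i l
  rw [← coeff_planeExponents_planeGenerators h.two_le, ← h.map_generator, ← hc i, map_sum,
    coeff_sum]
  change ∑ j, constantCoeff (c i j) * _ = _
  refine Finset.sum_congr rfl fun j _ ↦ ?_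
  rw [map_mul, coeff_mul_planeExponents h.two_le
    (h.coeff_eq_zero (g j) (hg ▸ Ideal.subset_span ⟨j, rfl⟩)), h.constantCoeff_map]

theorem three_le_spanFinrank (h : PlaneReduction J k p q π f) (hJ : J.FG) :
    3 ≤ J.spanFinrank := by
  obtain ⟨g, hg⟩ := exists_span_range_eq_of_spanFinrank_le hJ le_rfl
  obtain ⟨c, θ, -, hcθ⟩ := h.exists_matrix hg
  have h1 := Matrix.rank_mul_le_left (c.map constantCoeff) θ
  rw [hcθ, Matrix.rank_one, Fintype.card_fin] at h1
  exact h1.trans ((Matrix.rank_le_width _))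

/-- With three generators `g` the matrix `c` is square, and its determinant has nonzero constant
term. By Cramer's rule `det c` multiplies each `g j` into `(f)`, so Nakayama applies with `g₁ = g₂ =
0`. -/
theorem eq_span_of_spanFinrank_le (h : PlaneReduction J k p q π f) (hJ : J.FG)
    (hrank : J.spanFinrank ≤ 3) : J = Ideal.span (Set.range f) := by
  obtain ⟨g, hg⟩ := exists_span_range_eq_of_spanFinrank_le hJ hrank
  obtain ⟨c, θ, hc, hcθ⟩ := h.exists_matrix hg
  refine h.eq_span_of_forall_exists fun x hx ↦ ⟨c.det, ?_, 0, zero_mem _, 0, zero_mem _, ?_⟩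
  · rw [RingHom.map_det]
    intro h0
    have := congrArg Matrix.det hcθ
    rw [Matrix.det_mul, Matrix.det_one] at this
    exact one_ne_zero (this.symm.trans (by rw [show (c.map constantCoeff).det = 0 from h0, zero_mul]))
  · rw [mul_zero, mul_zero, add_zero, sub_zero]
    have hj : ∀ j, c.det * g j ∈ Ideal.span (Set.range f) := by
      intro j
      have hv : c.det • g = c.adjugate.mulVec f := by
        have : f = c.mulVec g := funext fun i ↦ hc i
        rw [this, Matrix.mulVec_mulVec, Matrix.adjugate_mul, Matrix.smul_mulVec, Matrix.one_mulVec]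
      have := congrFun hv j
      rw [Pi.smul_apply, smul_eq_mul] at this
      rw [this]
      change ∑ i, c.adjugate j i * f i ∈ Ideal.span (Set.range f)
      exact Ideal.sum_mem _ fun i _ ↦
        Ideal.mul_mem_left _ _ (Ideal.subset_span (Set.mem_range_self i))
    obtain ⟨b, rfl⟩ := Ideal.mem_span_range_iff_exists_fun.mp 
      (hg.symm ▸ hx : x ∈ Ideal.span (Set.range g))
    rw [Finset.mul_sum]
    refine Ideal.sum_mem _ fun j _ ↦ ?_
    rw [mul_left_comm]
    exact Ideal.mul_mem_left _ _ (hj j)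

theorem spanFinrank_eq_three (h : PlaneReduction J k p q π f)
    (hJ : J = Ideal.span (Set.range f)) : J.spanFinrank = 3 := by
  refine le_antisymm ?_ (h.three_le_spanFinrank ?_)
  · rw [hJ]
    refine (Submodule.spanFinrank_span_le_ncard_of_finite (Set.finite_range f)).trans ?_
    rw [← Set.image_univ]
    exact (Set.ncard_image_le Set.finite_univ).trans (by simp)
  · rw [hJ]
    exact (Submodule.fg_span (Set.finite_range f))

/-- For `g` in `J` write `g = j + v p + w q` with `j` in `(f)`. Then `p v + q w` vanishes in `F`, so
for some `s` outside the maximal ideal `s v ≡ q t` and `s w ≡ -p t` modulo `J`. Hence `s g = s j + p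
(s v - q t) + q (s w + p t)` with both brackets in `J`, as Nakayama requires. -/
theorem eq_span_of_isCohenMacaulay (h : PlaneReduction J k p q π f) {F : Type*} [CommRing F]
    {φ : MvPolynomial σ K →+* F} (hφ : Function.Surjective φ) (hker : RingHom.ker φ = J)
    (hdim : 2 ≤ (Ideal.map φ (RingHom.ker (constantCoeff (R := K) (σ := σ)))).height)
    (hF : IsCohenMacaulay F) : J = Ideal.span (Set.range f) := by
  set M := RingHom.ker (constantCoeff (R := K) (σ := σ))
  have hM : M.IsMaximal := 
    RingHom.ker_isMaximal_of_surjective _ fun c ↦ ⟨C c, constantCoeff_C σ c⟩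
  have hJM : RingHom.ker φ ≤ M := by
    intro g hg
    rw [hker] at hg
    rw [RingHom.mem_ker, ← h.constantCoeff_map]
    simpa [constantCoeff_eq] using h.coeff_eq_zero g hg 0 0 (by have := h.two_le; omega)
  have hmem : ∀ x, φ x ∈ Ideal.map φ M → x ∈ M := by
    intro x hx
    have : x ∈ (Ideal.map φ M).comap φ := hx
    rwa [Ideal.comap_map_of_surjective' φ hφ, sup_eq_left.mpr hJM] at this
  have hm : (Ideal.map φ M).IsMaximal :=
    (Ideal.map_eq_top_or_isMaximal_of_surjective φ hφ hM).resolve_left fun htop ↦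
      hM.ne_top ((Ideal.eq_top_iff_one M).mpr (hmem 1 (by rw [htop]; trivial)))
  -- Modulo `p, q` the ring is `K[x, y] / (x * y, x ^ k, y ^ k)`, where the variables are nilpotent.
  have hpq : ∀ x ∈ Ideal.map φ M, ∃ N, x ^ N ∈ Ideal.span {φ p, φ q} := by
    intro x hx
    obtain ⟨y, rfl⟩ := hφ x
    obtain ⟨N, hN⟩ := exists_pow_mem_span_planeGenerators
      ((h.constantCoeff_map y).trans (hmem y hx)) k
    rw [← map_pow] at hN
    obtain ⟨g, hg, hyg⟩ := h.exists_sub_mem hN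
    refine ⟨N, ?_⟩
    have hφg : φ g = 0 := by
      rw [← RingHom.mem_ker, hker]; exact h.span_le hg
    rw [← map_pow, ← sub_zero (φ (y ^ N)), ← hφg, ← map_sub, ← Set.image_pair, ← Ideal.map_span]
    exact Ideal.mem_map_of_mem _ hyg
  refine h.eq_span_of_forall_exists fun g hg ↦ ?_
  obtain ⟨j, hj, hgj⟩ := h.exists_sub_mem (mem_span_planeGenerators (h.coeff_eq_zero g hg))
  obtain ⟨v, w, hvw⟩ := Ideal.mem_span_pair.mp hgj
  have h0 : φ p * φ v + φ q * φ w = 0 := by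
    rw [← map_mul, ← map_mul, ← map_add, ← RingHom.mem_ker, hker, mul_comm p, mul_comm q, hvw]
    exact sub_mem hg (h.span_le hj)
  obtain ⟨s, hs, t, hv, hw⟩ := IsCohenMacaulayLocal.exists_mul_eq (hF.2 (Ideal.map φ M)) hdim hpq h0
  obtain ⟨s, rfl⟩ := hφ s
  obtain ⟨t, rfl⟩ := hφ t
  refine ⟨s, fun h ↦ hs (Ideal.mem_map_of_mem _ h), s * v - q * t, ?_, s * w + p * t, ?_, ?_⟩
  · rw [← hker, RingHom.mem_ker]; simp [hv]
  · rw [← hker, RingHom.mem_ker]; simp [hw]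
  · have : s * g - (p * (s * v - q * t) + q * (s * w + p * t)) = s * j := by
      linear_combination -s * hvw
    rw [this]
    exact Ideal.mul_mem_left _ _ hj

end PlaneReduction

/-- If an ideal is contained in the kernel of a homomorphism to `K[x, y]` that maps two variables
to a positive power of `x` and of `y`, then the maximal ideal of the origin has height at least two
in the quotient. -/
theorem two_le_height_map {K σ F : Type*} [Field K] [CommRing F]
    {φ : MvPolynomial σ K →+* F} (hφ : Function.Surjective φ) {v : σ → MvPolynomial (Fin 2) K}
    (hv : ∀ i, constantCoeff (v i) = 0) {n : ℕ} (hn : 0 < n) {i j : σ} (hi : v i = X 0 ^ n)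
    (hj : v j = X 1 ^ n) (hker : ∀ g ∈ RingHom.ker φ, aeval v g = 0) :
    2 ≤ (Ideal.map φ (RingHom.ker (constantCoeff (R := K) (σ := σ)))).height := by
  set M := RingHom.ker (constantCoeff (R := K) (σ := σ))
  set P₀ := RingHom.ker (aeval (R := K) v).toRingHom
  -- Setting `y = 0` after `v` gives the middle prime of the chain `P₀ < P₁ < M`; `X j` separates
  -- the first two and `X i` the last two.
  let ε : MvPolynomial (Fin 2) K →ₐ[K] Polynomial K := aeval ![Polynomial.X, 0]
  set P₁ := RingHom.ker (ε.comp (aeval (R := K) v)).toRingHom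
  have h01 : P₀ ≤ P₁ := fun g (hg : aeval v g = 0) ↦ by
    change ε (aeval v g) = 0
    rw [hg, map_zero]
  have hconst : ∀ g : MvPolynomial σ K,
      (ε (aeval v g)).coeff 0 = constantCoeff g := by
    have h1 : (Polynomial.constantCoeff).comp ε.toRingHom =
        (constantCoeff : MvPolynomial (Fin 2) K →+* K) := by
      refine ringHom_ext (fun r ↦ by simp [ε]) fun i ↦ ?_
      fin_cases i <;> simp [ε]
    have h2 : (constantCoeff : MvPolynomial (Fin 2) K →+* K).comp (aeval (R := K) v).toRingHom =
        constantCoeff := by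
      refine ringHom_ext (fun r ↦ by simp) fun i ↦ ?_
      simp [hv]
    intro g
    rw [← h2, ← h1]
    rfl
  have h1M : P₁ ≤ M := fun g (hg : ε (aeval v g) = 0) ↦ by
    rw [RingHom.mem_ker, ← hconst, hg, Polynomial.coeff_zero]
  have hlt : ∀ P Q : Ideal (MvPolynomial σ K), RingHom.ker φ ≤ P → P ≤ Q → (∃ x ∈ Q, x ∉ P) →
      Ideal.map φ P < Ideal.map φ Q := by
    rintro P Q hP hPQ ⟨x, hxQ, hxP⟩
    refine lt_of_le_of_ne (Ideal.map_mono hPQ) fun heq ↦ hxP ?_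
    have : x ∈ (Ideal.map φ P).comap φ := heq ▸ Ideal.mem_map_of_mem φ hxQ
    rwa [Ideal.comap_map_of_surjective' φ hφ, sup_eq_left.mpr hP] at this
  have hk0 : RingHom.ker φ ≤ P₀ := fun g hg ↦ hker g hg
  have : P₀.IsPrime := RingHom.ker_isPrime _
  have : P₁.IsPrime := RingHom.ker_isPrime _
  have : M.IsPrime := RingHom.ker_isPrime _
  have hp0 : (Ideal.map φ P₀).IsPrime :=
    Ideal.map_isPrime_of_surjective hφ hk0
  have hp1 : (Ideal.map φ P₁).IsPrime :=
    Ideal.map_isPrime_of_surjective hφ (hk0.trans h01)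
  have hpM : (Ideal.map φ M).IsPrime :=
    Ideal.map_isPrime_of_surjective hφ ((hk0.trans h01).trans h1M)
  have hl1 := Ideal.height_add_one_le_of_lt_of_isPrime
    (hlt P₀ P₁ hk0 h01 ⟨X j, by
      change ε (aeval v (X j)) = 0
      simp [hj, ε, hn.ne'], fun h ↦ by
      change aeval v (X j) = 0 at h
      rw [aeval_X, hj] at h
      exact pow_ne_zero n (X_ne_zero _) h⟩)
  have hl2 := Ideal.height_add_one_le_of_lt_of_isPrime
    (hlt P₁ M (hk0.trans h01) h1M ⟨X i, RingHom.mem_ker.mpr (constantCoeff_X K i), fun h ↦ by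
      change ε (aeval v (X i)) = 0 at h
      simp [hi, ε] at h⟩)
  calc (2 : ℕ∞) ≤ (Ideal.map φ P₀).height + 1 + 1 := by
        rw [add_assoc]; exact le_add_left (by norm_num)
    _ ≤ _ := le_trans (by gcongr) hl2

/-! ### Freeness over a polynomial ring on the powers of two elements -/

/-- The powers `1, s, …, s ^ (k - 1)` and `t, …, t ^ (k - 1)`. -/
def axisPowers {F : Type*} [Monoid F] (s t : F) (k : ℕ) : Fin k ⊕ Fin (k - 1) → F :=
  Sum.elim (fun r ↦ s ^ (r : ℕ)) fun r ↦ t ^ ((r : ℕ) + 1)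

section AxisPowers

variable {A F : Type*} [CommRing A] [CommRing F] [Algebra A F] {s t : F} {k : ℕ}

theorem pow_left_mem_span_axisPowers {r : ℕ} (hr : r < k) :
    s ^ r ∈ Submodule.span A (Set.range (axisPowers s t k)) :=
  Submodule.subset_span ⟨Sum.inl ⟨r, hr⟩, rfl⟩

theorem pow_right_mem_span_axisPowers {r : ℕ} (hr : r < k) :
    t ^ r ∈ Submodule.span A (Set.range (axisPowers s t k)) := by
  rcases Nat.eq_zero_or_pos r with rfl | h
  · simpa using pow_left_mem_span_axisPowers (A := A) (s := s) (t := t) hr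
  · refine Submodule.subset_span ⟨Sum.inr ⟨r - 1, by omega⟩, ?_⟩
    simp [axisPowers, Nat.sub_add_cancel h]

/-- The formula for `s * t` rewrites `s * t ^ r` and `t * s ^ r` with smaller mixed products, and
`hs`, `ht` handle the top powers. -/
theorem mul_mem_span_axisPowers {x y z : A}
    (hst : s * t = algebraMap A F x + algebraMap A F y * s + algebraMap A F z * t)
    (hs : s ^ k ∈ Submodule.span A (Set.range (axisPowers s t k)))
    (ht : t ^ k ∈ Submodule.span A (Set.range (axisPowers s t k)))
    {g : F} (hg : g ∈ Submodule.span A (Set.range (axisPowers s t k))) :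
    s * g ∈ Submodule.span A (Set.range (axisPowers s t k)) ∧
      t * g ∈ Submodule.span A (Set.range (axisPowers s t k)) := by
  set L := Submodule.span A (Set.range (axisPowers s t k))
  have hs' : ∀ r ≤ k, s ^ r ∈ L := fun r hr ↦ by
    rcases hr.lt_or_eq with h | rfl
    exacts [pow_left_mem_span_axisPowers h, hs]
  have ht' : ∀ r ≤ k, t ^ r ∈ L := fun r hr ↦ by
    rcases hr.lt_or_eq with h | rfl
    exacts [pow_right_mem_span_axisPowers h, ht]
  have hst' : ∀ r < k, s * t ^ r ∈ L := by
    intro r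
    induction r with
    | zero => intro hr; simpa using hs' 1 hr
    | succ r ih =>
      intro hr
      have : s * t ^ (r + 1) = x • t ^ r + y • (s * t ^ r) + z • t ^ (r + 1) := by
        simp only [Algebra.smul_def]
        linear_combination t ^ r * hst
      rw [this]
      exact add_mem (add_mem (L.smul_mem _ (ht' r (by omega))) (L.smul_mem _ (ih (by omega))))
        (L.smul_mem _ (ht' _ hr.le))
  have hts' : ∀ r < k, t * s ^ r ∈ L := by
    intro r
    induction r with
    | zero => intro hr; simpa using ht' 1 hr
    | succ r ih =>
      intro hr
      have : t * s ^ (r + 1) = x • s ^ r + y • s ^ (r + 1) + z • (t * s ^ r) := by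
        simp only [Algebra.smul_def]
        linear_combination s ^ r * hst
      rw [this]
      exact add_mem (add_mem (L.smul_mem _ (hs' r (by omega))) (L.smul_mem _ (hs' _ hr.le)))
        (L.smul_mem _ (ih (by omega)))
  induction hg using Submodule.span_induction with
  | mem g hg =>
    obtain ⟨r | r, rfl⟩ := hg
    · exact ⟨by simpa [axisPowers, ← pow_succ'] using hs' (r + 1) r.2, hts' r r.2⟩
    · exact ⟨hst' (r + 1) (by omega),
        by simpa [axisPowers, ← pow_succ'] using ht' (r + 1 + 1) (by omega)⟩
  | zero => simp
  | add g h _ _ hg hh => simpa only [mul_add] using ⟨add_mem hg.1 hh.1, add_mem hg.2 hh.2⟩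
  | smul a g _ hg => simpa only [mul_smul_comm] using ⟨L.smul_mem a hg.1, L.smul_mem a hg.2⟩

theorem span_axisPowers_eq_top {x y z : A} (hk : 0 < k)
    (hst : s * t = algebraMap A F x + algebraMap A F y * s + algebraMap A F z * t)
    (hs : s ^ k ∈ Submodule.span A (Set.range (axisPowers s t k)))
    (ht : t ^ k ∈ Submodule.span A (Set.range (axisPowers s t k)))
    (htop : Algebra.adjoin A {s, t} = ⊤) :
    Submodule.span A (Set.range (axisPowers s t k)) = ⊤ := by
  refine Submodule.eq_top_iff'.mpr fun f ↦ ?_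
  suffices ∀ g ∈ Submodule.span A (Set.range (axisPowers s t k)),
      f * g ∈ Submodule.span A (Set.range (axisPowers s t k)) by
    simpa using this 1 (by simpa using pow_left_mem_span_axisPowers (A := A) (s := s) (t := t) hk)
  have hf : f ∈ Algebra.adjoin A {s, t} := htop ▸ trivial
  induction hf using Algebra.adjoin_induction with
  | mem f hf =>
    intro g hg
    rcases hf with rfl | rfl
    · exact (mul_mem_span_axisPowers hst hs ht hg).1
    · exact (mul_mem_span_axisPowers hst hs ht hg).2
  | algebraMap a =>
    intro g hg
    rw [← Algebra.smul_def]
    exact Submodule.smul_mem _ _ hg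
  | add f f' _ _ hf hf' =>
    intro g hg
    rw [add_mul]
    exact add_mem (hf g hg) (hf' g hg)
  | mul f f' _ _ hf hf' =>
    intro g hg
    rw [mul_assoc]
    exact hf _ (hf' g hg)

theorem pow_mem_span_of_monic {P : Polynomial A} (hP : P.Monic) {x : F}
    (hx : Polynomial.aeval x P = 0) {M : Submodule A F} (hM : ∀ r < P.natDegree, x ^ r ∈ M) :
    x ^ P.natDegree ∈ M := by
  rw [hP.as_sum] at hx
  simp only [map_add, map_pow, Polynomial.aeval_X, map_sum, map_mul, Polynomial.aeval_C] at hx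
  rw [eq_neg_of_add_eq_zero_left hx]
  refine neg_mem (sum_mem fun r hr ↦ ?_)
  rw [← Algebra.smul_def]
  exact M.smul_mem _ (hM r (Finset.mem_range.mp hr))

end AxisPowers

/-- Two evaluations of a relation between the powers of `s` and `t`, one at constant `s` and one
at constant `t`, with values divisible by monic polynomials of degree `k`, force the relation to be
trivial. -/
theorem linearIndependent_axisPowers {A F R : Type*} [CommRing A] [IsDomain A] [CommRing F]
    [Algebra A F] [CommRing R] (φ : R →+* F) (ψ : A →+* R)
    (hψ : ∀ a, φ (ψ a) = algebraMap A F a) {s t : R} {k : ℕ}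
    {e₁ e₂ : R →+* Polynomial A} (h₁ : ∀ a, e₁ (ψ a) = Polynomial.C a)
    (h₂ : ∀ a, e₂ (ψ a) = Polynomial.C a) {α : A} (hs₁ : e₁ s = Polynomial.C α)
    (ht₁ : e₁ t = Polynomial.X) (hs₂ : e₂ s = Polynomial.X)
    {P₁ P₂ : Polynomial A} (hP₁ : P₁.Monic) (hP₂ : P₂.Monic) (hd₁ : P₁.natDegree = k)
    (hd₂ : P₂.natDegree = k) (hk : 0 < k)
    (hker₁ : ∀ g, φ g = 0 → P₁ ∣ e₁ g) (hker₂ : ∀ g, φ g = 0 → P₂ ∣ e₂ g) :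
    LinearIndependent A (axisPowers (φ s) (φ t) k) := by
  rw [Fintype.linearIndependent_iff]
  intro c hc
  set g : R := ∑ i, ψ (c i) * axisPowers s t k i with hgdef
  have hg : φ g = 0 := by
    rw [← hc, hgdef, map_sum]
    refine Finset.sum_congr rfl fun i _ ↦ ?_
    rw [map_mul, hψ, Algebra.smul_def]
    rcases i with i | i <;> simp [axisPowers]
  have hzero : ∀ {P Q : Polynomial A}, P.Monic → P.natDegree = k → P ∣ Q → Q.natDegree < k →
      Q = 0 := by
    intro P Q hP hd hdvd hQ
    by_contra h0
    exact absurd (Polynomial.natDegree_le_of_dvd hdvd h0) (by omega)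
  -- Under `e₁` the powers of `s` are constants, so the relation is a polynomial in `t` of degree
  -- less than `k`. Divisible by the monic `P₁`, it is zero, and its positive-degree coefficients
  -- are those of the powers of `t`. Then `e₂` treats the powers of `s`.
  have hr : ∀ i : Fin (k - 1), c (Sum.inr i) = 0 := by
    have he : e₁ g = Polynomial.C (∑ i : Fin k, c (Sum.inl i) * α ^ (i : ℕ)) +
        ∑ i : Fin (k - 1), Polynomial.C (c (Sum.inr i)) * Polynomial.X ^ ((i : ℕ) + 1) := by
      rw [hgdef, Fintype.sum_sum_type, map_add, map_sum, map_sum, map_sum]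
      simp [axisPowers, h₁, hs₁, ht₁]
    generalize ∑ i : Fin k, c (Sum.inl i) * α ^ (i : ℕ) = w at he
    have h0 : e₁ g = 0 := by
      refine hzero hP₁ hd₁ (hker₁ g hg) ?_
      rw [he]
      refine Nat.lt_of_le_pred hk ((Polynomial.natDegree_add_le _ _).trans (max_le (by simp) ?_))
      refine Polynomial.natDegree_sum_le_of_forall_le _ _ fun i _ ↦ ?_
      exact (Polynomial.natDegree_C_mul_X_pow_le _ _).trans (by rw [Nat.pred_eq_sub_one]; omega)
    intro i
    have := congrArg (fun Q ↦ Polynomial.coeff Q ((i : ℕ) + 1)) (he.symm.trans h0)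
    simpa [Polynomial.coeff_C, Polynomial.finsetSum_coeff, Polynomial.coeff_X_pow, Fin.val_inj]
      using this
  have hl : ∀ i : Fin k, c (Sum.inl i) = 0 := by
    have he : e₂ g =
        ∑ i : Fin k, Polynomial.C (c (Sum.inl i)) * Polynomial.X ^ (i : ℕ) := by
      rw [hgdef, Fintype.sum_sum_type, map_add, map_sum, map_sum]
      simp [axisPowers, h₂, hs₂, hr]
    have h0 : e₂ g = 0 := by
      refine hzero hP₂ hd₂ (hker₂ g hg) ?_
      rw [he]
      refine Nat.lt_of_le_pred hk (Polynomial.natDegree_sum_le_of_forall_le _ _ fun i _ ↦ ?_)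
      exact (Polynomial.natDegree_C_mul_X_pow_le _ _).trans (by rw [Nat.pred_eq_sub_one]; omega)
    intro i
    have := congrArg (fun Q ↦ Polynomial.coeff Q (i : ℕ)) (he.symm.trans h0)
    simpa [Polynomial.finsetSum_coeff, Polynomial.coeff_X_pow, Fin.val_inj]
      using this
  rintro (i | i)
  exacts [hl i, hr i]

theorem isCohenMacaulay_of_linearIndependent_axisPowers {K F : Type*} [Field K] [CommRing F]
    [Algebra (MvPolynomial (Fin 2) K) F] {s t : F} {k : ℕ} (hk : 0 < k)
    {x y z : MvPolynomial (Fin 2) K}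
    (hst : s * t = algebraMap _ F x + algebraMap _ F y * s + algebraMap _ F z * t)
    (hs : s ^ k ∈ Submodule.span (MvPolynomial (Fin 2) K) (Set.range (axisPowers s t k)))
    (ht : t ^ k ∈ Submodule.span (MvPolynomial (Fin 2) K) (Set.range (axisPowers s t k)))
    (htop : Algebra.adjoin (MvPolynomial (Fin 2) K) {s, t} = ⊤)
    (hli : LinearIndependent (MvPolynomial (Fin 2) K) (axisPowers s t k)) :
    IsCohenMacaulay F := by
  let b := Module.Basis.mk hli (span_axisPowers_eq_top hk hst hs ht htop).ge
  have := Module.Finite.of_basis b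
  have := Module.Free.of_basis b
  exact isCohenMacaulay_of_finite_of_free K F

/-- The monomials `x ^ v i` with `v i 0` pairwise incongruent modulo `c` are linearly independent
over `K[x ^ c, y ^ c]`. -/
theorem eq_zero_of_sum_expand_mul_monomial {K ι : Type*} [Field K] [Fintype ι] {c : ℕ} (hc : c ≠ 0)
    {v : ι → Fin 2 →₀ ℕ} (hv : ∀ i j, v i 0 ≡ v j 0 [MOD c] → i = j)
    {h : ι → MvPolynomial (Fin 2) K} (hh : ∑ i, expand c (h i) * monomial (v i) 1 = 0) (i : ι) :
    h i = 0 := by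
  ext μ
  -- Another term could reach this monomial only if `v j 0` and `v i 0` were congruent modulo `c`.
  have h0 := congrArg (coeff (c • μ + v i)) hh
  rw [coeff_sum, Finset.sum_eq_single i] at h0
  · rwa [coeff_mul_monomial (c • μ) (v i), mul_one, coeff_expand_smul c hc] at h0
  · intro j _ hj
    rw [coeff_mul_monomial', mul_one]
    split_ifs with hle
    · have hle0 : v j 0 ≤ (c • μ + v i) 0 := Finsupp.le_def.mp hle 0
      have hnd : ¬ c ∣ (c • μ + v i - v j) 0 := by
        intro hdvd
        rw [Finsupp.tsub_apply] at hdvd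
        have h1 := (Nat.modEq_iff_dvd' hle0).mpr hdvd
        refine hj (hv j i (h1.trans ?_))
        simp [Nat.ModEq]
      exact coeff_expand_of_not_dvd _ hnd
    · rfl
  · simp

/-! ### Exponent criteria for the symmetric ideal -/

section SymmetricIdeal

variable {K : Type*} [Field K] {a b c : ℕ}

/-- The exponent vectors of the generators of the symmetric ideal. -/
noncomputable def symmetricExponents (a b c : ℕ) : Fin 4 → Fin 2 →₀ ℕ :=
  ![Finsupp.single 0 c, Finsupp.single 0 b + Finsupp.single 1 a,
    Finsupp.single 0 a + Finsupp.single 1 b, Finsupp.single 1 c]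

theorem symmetricGenerators_eq_monomial (i : Fin 4) :
    symmetricGenerators K a b c i = monomial (symmetricExponents a b c i) 1 := by
  fin_cases i <;> simp [symmetricGenerators, symmetricExponents, X, monomial_mul, monomial_pow]

theorem linearCombination_symmetricExponents_zero (m : Fin 4 →₀ ℕ) :
    Finsupp.linearCombination ℕ (symmetricExponents a b c) m 0 = c * m 0 + b * m 1 + a * m 2 := by
  rw [Finsupp.linearCombination_apply, Finsupp.sum_fintype _ _ (by simp), Fin.sum_univ_four]
  simp [symmetricExponents]
  ring

theorem linearCombination_symmetricExponents_one (m : Fin 4 →₀ ℕ) :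
    Finsupp.linearCombination ℕ (symmetricExponents a b c) m 1 = a * m 1 + b * m 2 + c * m 3 := by
  rw [Finsupp.linearCombination_apply, Finsupp.sum_fintype _ _ (by simp), Fin.sum_univ_four]
  simp [symmetricExponents]
  ring

theorem degree_fin_four (m : Fin 4 →₀ ℕ) : m.degree = m 0 + m 1 + m 2 + m 3 := by
  rw [Finsupp.degree_eq_sum, Fin.sum_univ_four]

variable (K a b c) in
/-- The defining ideal of the fiber cone of the symmetric ideal. -/
noncomputable abbrev symmetricDefiningIdeal : Ideal (MvPolynomial (Fin 4) K) :=
  fiberConeDefiningIdeal (symmetricGenerators K a b c)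

theorem coeff_eq_zero_of_mem_symmetricDefiningIdeal {g : MvPolynomial (Fin 4) K}
    (hg : g ∈ symmetricDefiningIdeal K a b c) {m : Fin 4 →₀ ℕ}
    (hm : ∀ n₀ n₁ n₂ n₃ : ℕ, n₀ + n₁ + n₂ + n₃ = m 0 + m 1 + m 2 + m 3 →
      c * n₀ + b * n₁ + a * n₂ ≤ c * m 0 + b * m 1 + a * m 2 →
      a * n₁ + b * n₂ + c * n₃ ≤ a * m 1 + b * m 2 + c * m 3 →
      n₀ = m 0 ∧ n₁ = m 1 ∧ n₂ = m 2 ∧ n₃ = m 3) :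
    coeff m g = 0 := by
  refine coeff_eq_zero_of_mem_fiberConeDefiningIdeal symmetricGenerators_eq_monomial hg
    fun n hn hle ↦ ?_
  have h0 := Finsupp.le_def.mp hle 0
  have h1 := Finsupp.le_def.mp hle 1
  simp only [linearCombination_symmetricExponents_zero,
    linearCombination_symmetricExponents_one, degree_fin_four] at h0 h1 hn
  obtain ⟨e0, e1, e2, e3⟩ := hm _ _ _ _ hn h0 h1
  ext i
  fin_cases i <;> assumption

/-- The monomial `z₀ ^ m₀ * z₁ ^ m₁ * z₂ ^ m₂ * z₃ ^ m₃`. -/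
noncomputable def quadMonomial (K : Type*) [Field K] (m₀ m₁ m₂ m₃ : ℕ) : MvPolynomial (Fin 4) K :=
  X 0 ^ m₀ * X 1 ^ m₁ * X 2 ^ m₂ * X 3 ^ m₃

theorem isHomogeneous_quadMonomial (m₀ m₁ m₂ m₃ : ℕ) :
    (quadMonomial K m₀ m₁ m₂ m₃).IsHomogeneous (m₀ + m₁ + m₂ + m₃) := by
  have h := ((((isHomogeneous_X_pow (R := K) (0 : Fin 4) m₀).mul
    (isHomogeneous_X_pow (1 : Fin 4) m₁)).mul (isHomogeneous_X_pow (2 : Fin 4) m₂)).mul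
    (isHomogeneous_X_pow (3 : Fin 4) m₃))
  simpa [quadMonomial] using h

theorem aeval_symmetricGenerators_quadMonomial (m₀ m₁ m₂ m₃ : ℕ) :
    aeval (symmetricGenerators K a b c) (quadMonomial K m₀ m₁ m₂ m₃) =
      X 0 ^ (c * m₀ + b * m₁ + a * m₂) * X 1 ^ (a * m₁ + b * m₂ + c * m₃) := by
  simp [quadMonomial, symmetricGenerators]
  ring

theorem X_pow_mul_X_pow_mem_idealOfVars {i j : ℕ} (h : 0 < i + j) :
    (X 0 ^ i * X 1 ^ j : MvPolynomial (Fin 2) K) ∈ idealOfVars (Fin 2) K := by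
  apply mem_idealOfVars_of_constantCoeff_eq_zero
  rcases Nat.eq_zero_or_pos i with rfl | hi
  · have hj : j ≠ 0 := by omega
    simp [hj]
  · simp [hi.ne']

/-- The value at `m` is a nonconstant monomial times the value at `n`; strict inequality of total
degrees ensures that the quotient lies in the ideal of the variables. -/
theorem quadMonomial_mem_symmetricDefiningIdeal {m₀ m₁ m₂ m₃ n₀ n₁ n₂ n₃ : ℕ}
    (hd : n₀ + n₁ + n₂ + n₃ = m₀ + m₁ + m₂ + m₃)
    (hx : c * n₀ + b * n₁ + a * n₂ ≤ c * m₀ + b * m₁ + a * m₂)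
    (hy : a * n₁ + b * n₂ + c * n₃ ≤ a * m₁ + b * m₂ + c * m₃)
    (hlt : c * n₀ + b * n₁ + a * n₂ + (a * n₁ + b * n₂ + c * n₃) <
      c * m₀ + b * m₁ + a * m₂ + (a * m₁ + b * m₂ + c * m₃)) :
    quadMonomial K m₀ m₁ m₂ m₃ ∈ symmetricDefiningIdeal K a b c := by
  refine mem_fiberConeDefiningIdeal_of_isHomogeneous _ (isHomogeneous_quadMonomial m₀ m₁ m₂ m₃) ?_
  obtain ⟨i, hi⟩ := Nat.exists_eq_add_of_le hx
  obtain ⟨j, hj⟩ := Nat.exists_eq_add_of_le hy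
  have hmem : aeval (symmetricGenerators K a b c) (quadMonomial K n₀ n₁ n₂ n₃) ∈
      Ideal.span (Set.range (symmetricGenerators K a b c)) ^ (m₀ + m₁ + m₂ + m₃) := by
    have hu : ∀ i, symmetricGenerators K a b c i ∈
        Ideal.span (Set.range (symmetricGenerators K a b c)) := fun i ↦
      Ideal.subset_span ⟨i, rfl⟩
    rw [← hd]
    simp only [quadMonomial, map_mul, map_pow, aeval_X, pow_add]
    exact Ideal.mul_mem_mul (Ideal.mul_mem_mul (Ideal.mul_mem_mul (Ideal.pow_mem_pow (hu 0) _)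
      (Ideal.pow_mem_pow (hu 1) _)) (Ideal.pow_mem_pow (hu 2) _)) (Ideal.pow_mem_pow (hu 3) _)
  have : aeval (symmetricGenerators K a b c) (quadMonomial K m₀ m₁ m₂ m₃) =
      X 0 ^ i * X 1 ^ j * aeval (symmetricGenerators K a b c) (quadMonomial K n₀ n₁ n₂ n₃) := by
    rw [aeval_symmetricGenerators_quadMonomial, aeval_symmetricGenerators_quadMonomial, hi, hj]
    ring
  rw [this]
  exact Ideal.mul_mem_mul (X_pow_mul_X_pow_mem_idealOfVars (by omega)) hmem

theorem quadMonomial_sub_mem_symmetricDefiningIdeal {m₀ m₁ m₂ m₃ n₀ n₁ n₂ n₃ : ℕ}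
    (hd : n₀ + n₁ + n₂ + n₃ = m₀ + m₁ + m₂ + m₃)
    (hx : c * n₀ + b * n₁ + a * n₂ = c * m₀ + b * m₁ + a * m₂)
    (hy : a * n₁ + b * n₂ + c * n₃ = a * m₁ + b * m₂ + c * m₃) :
    quadMonomial K m₀ m₁ m₂ m₃ - quadMonomial K n₀ n₁ n₂ n₃ ∈ symmetricDefiningIdeal K a b c := by
  refine mem_fiberConeDefiningIdeal_of_isHomogeneous _ (j := m₀ + m₁ + m₂ + m₃) ?_ ?_
  · exact (isHomogeneous_quadMonomial m₀ m₁ m₂ m₃).sub (hd ▸ isHomogeneous_quadMonomial n₀ n₁ n₂ n₃)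
  · rw [map_sub, aeval_symmetricGenerators_quadMonomial, aeval_symmetricGenerators_quadMonomial,
      hx, hy, sub_self]
    exact zero_mem _

theorem coeff_aeval_eq_zero {w : Fin 4 → MvPolynomial (Fin 2) K} {ν : Fin 2 →₀ ℕ}
    {g : MvPolynomial (Fin 4) K}
    (h : ∀ m : Fin 4 →₀ ℕ,
      coeff ν (w 0 ^ m 0 * w 1 ^ m 1 * w 2 ^ m 2 * w 3 ^ m 3) ≠ 0 → coeff m g = 0) :
    coeff ν (aeval w g) = 0 := by
  rw [g.as_sum, map_sum, coeff_sum]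
  refine Finset.sum_eq_zero fun m hm ↦ ?_
  rw [aeval_monomial, Finsupp.prod_fintype _ _ (by simp), Fin.prod_univ_four, algebraMap_eq,
    coeff_C_mul]
  by_contra h0
  exact mem_support_iff.mp hm (h m (right_ne_zero_of_mul h0))

theorem eq_of_coeff_X_pow_mul_X_pow_ne_zero {ν : Fin 2 →₀ ℕ} {i j : ℕ}
    (h : coeff ν (X 0 ^ i * X 1 ^ j : MvPolynomial (Fin 2) K) ≠ 0) : ν 0 = i ∧ ν 1 = j := by
  classical
  have : (X 0 ^ i * X 1 ^ j : MvPolynomial (Fin 2) K) =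
      monomial (Finsupp.single 0 i + Finsupp.single 1 j) 1 := by
    simp [X, monomial_mul, monomial_pow]
  rw [this, coeff_monomial] at h
  split_ifs at h with h'
  · subst h'; simp
  · exact absurd rfl h

/-- The reduction of the defining ideal under `z₀ ↦ w 0`, `z₁ ↦ x`, `z₂ ↦ y`, `z₃ ↦ w 3`. -/
theorem planeReduction_of_coeff_eq_zero {w : Fin 4 → MvPolynomial (Fin 2) K} (hw1 : w 1 = X 0)
    (hw2 : w 2 = X 1) (hw : ∀ i, constantCoeff (w i) = 0) {k : ℕ} (hk : 2 ≤ k)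
    {p q : MvPolynomial (Fin 4) K} (hp : p.IsHomogeneous 1) (hq : q.IsHomogeneous 1)
    (hpw : p = X 0 - aeval ![X 1, X 2] (w 0)) (hqw : q = X 3 - aeval ![X 1, X 2] (w 3))
    {f : Fin 3 → MvPolynomial (Fin 4) K} (hf : ∀ i, f i ∈ symmetricDefiningIdeal K a b c)
    (hfh : ∀ i, ∃ d, (f i).IsHomogeneous d)
    (hfw : ∀ i, aeval w (f i) = planeGenerators K k i)
    (hcoeff : ∀ g ∈ symmetricDefiningIdeal K a b c, ∀ i, ∀ r < k,
      coeff (Finsupp.single i r) (aeval w g) = 0) :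
    PlaneReduction (symmetricDefiningIdeal K a b c) k p q (aeval w) f where
  two_le := hk
  homogeneousComponent_mem g hg d := homogeneousComponent_mem_fiberConeDefiningIdeal _ hg d
  isHomogeneous_left := hp
  isHomogeneous_right := hq
  mem_span_pair g hg := by
    -- `ρ` is a section of `aeval w`, and `ρ ∘ aeval w` fixes every variable modulo `p, q`.
    let ρ : MvPolynomial (Fin 2) K →ₐ[K] MvPolynomial (Fin 4) K := aeval ![X 1, X 2]
    let μ := Ideal.Quotient.mkₐ K (Ideal.span {p, q})
    have h : μ = (μ.comp ρ).comp (aeval w) := by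
      apply MvPolynomial.algHom_ext
      intro i
      change μ (X i) = μ (ρ (aeval w (X i)))
      rw [aeval_X, ← sub_eq_zero, ← map_sub]
      refine Ideal.Quotient.eq_zero_iff_mem.mpr ?_
      fin_cases i
      · exact Ideal.subset_span (Or.inl hpw.symm)
      · simp [hw1, ρ]
      · simp [hw2, ρ]
      · exact Ideal.subset_span (Or.inr hqw.symm)
    refine Ideal.Quotient.eq_zero_iff_mem.mp (?_ : μ g = 0)
    rw [h]
    change μ (ρ (aeval w g)) = 0
    rw [hg, map_zero, map_zero]
  surjective g := by
    refine ⟨aeval ![X 1, X 2] g, ?_⟩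
    have : (aeval w).comp (aeval ![X 1, X 2]) = AlgHom.id K (MvPolynomial (Fin 2) K) := by
      apply MvPolynomial.algHom_ext
      intro i
      fin_cases i <;> simp [hw1, hw2]
    exact DFunLike.congr_fun this g
  constantCoeff_map g := by
    have : (constantCoeff : MvPolynomial (Fin 2) K →+* K).comp (aeval (R := K) w).toRingHom =
        constantCoeff := by
      refine ringHom_ext (fun r ↦ by simp) fun i ↦ ?_
      simp [hw]
    exact DFunLike.congr_fun this g
  mem := hf
  isHomogeneous := hfh
  map_generator := hfw
  coeff_eq_zero := hcoeff

/-- The equivalence of the conditions, given a reduction to `K[x, y]` and the Cohen–Macaulayness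
of the quotient when the ideal has the expected generators. -/
theorem PlaneReduction.tfae {σ F : Type*} [Finite σ] [CommRing F] {J : Ideal (MvPolynomial σ K)}
    {k : ℕ} {p q : MvPolynomial σ K} {π : MvPolynomial σ K →ₐ[K] MvPolynomial (Fin 2) K}
    {f : Fin 3 → MvPolynomial σ K} (h : PlaneReduction J k p q π f)
    {φ : MvPolynomial σ K →+* F} (hφ : Function.Surjective φ) (hφJ : RingHom.ker φ = J)
    {v : σ → MvPolynomial (Fin 2) K} (hv : ∀ i, constantCoeff (v i) = 0) {n : ℕ} (hn : 0 < n)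
    {i j : σ} (hi : v i = X 0 ^ n) (hj : v j = X 1 ^ n) (hker : ∀ g ∈ J, aeval v g = 0)
    (hCM : J = Ideal.span (Set.range f) → IsCohenMacaulay F) :
    List.TFAE [IsCohenMacaulay F, J.spanFinrank ≤ 3, J.spanFinrank = 3] := by
  have hfg : J.FG := IsNoetherian.noetherian _
  tfae_have 1 → 3 := fun hF ↦ h.spanFinrank_eq_three <|
    h.eq_span_of_isCohenMacaulay hφ hφJ
      (two_le_height_map hφ hv hn hi hj (by rwa [hφJ])) hF
  tfae_have 3 → 2 := fun h ↦ h.le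
  tfae_have 2 → 1 := fun hr ↦ hCM (h.eq_span_of_spanFinrank_le hfg hr)
  tfae_finish

end SymmetricIdeal

/-! ### Cohen–Macaulayness for the expected monomial generators -/

section ExpectedGenerators

variable {K : Type*} [Field K]

theorem adjoin_eq_top_of_X_mem {A F : Type*} [CommRing A] [CommRing F] [Algebra A F]
    {φ : MvPolynomial (Fin 4) K →+* F} (hφ : Function.Surjective φ)
    {ψ : A →+* MvPolynomial (Fin 4) K} (hψ : ∀ a, φ (ψ a) = algebraMap A F a)
    (hC : ∀ c : K, ∃ a, ψ a = C c) {x₀ x₃ : A}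
    (h0 : X 0 = ψ x₀ ∨ X 0 = ψ x₀ + X 2) (h3 : X 3 = ψ x₃ ∨ X 3 = ψ x₃ + X 1) :
    Algebra.adjoin A {φ (X 1), φ (X 2)} = ⊤ := by
  have h1 : φ (X 1) ∈ Algebra.adjoin A {φ (X 1), φ (X 2)} :=
    Algebra.subset_adjoin (Or.inl rfl)
  have h2 : φ (X 2) ∈ Algebra.adjoin A {φ (X 1), φ (X 2)} :=
    Algebra.subset_adjoin (Or.inr rfl)
  have hψm : ∀ a, φ (ψ a) ∈ Algebra.adjoin A {φ (X 1), φ (X 2)} := fun a ↦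
    hψ a ▸ Subalgebra.algebraMap_mem _ a
  refine Algebra.eq_top_iff.mpr fun x ↦ ?_
  obtain ⟨g, rfl⟩ := hφ x
  induction g using MvPolynomial.induction_on with
  | C c =>
    obtain ⟨a, ha⟩ := hC c
    exact ha ▸ hψm a
  | add g h hg hh => rw [map_add]; exact add_mem hg hh
  | mul_X g i hg =>
    rw [map_mul]
    refine mul_mem hg ?_
    fin_cases i
    · rcases h0 with h | h
      · exact h ▸ hψm x₀
      · change φ (X 0) ∈ _
        rw [h, map_add]
        exact add_mem (hψm x₀) h2
    · exact h1
    · exact h2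
    · rcases h3 with h | h
      · exact h ▸ hψm x₃
      · change φ (X 3) ∈ _
        rw [h, map_add]
        exact add_mem (hψm x₃) h1

/-- `F` becomes an algebra over `K[x, y]` through `p, q`, and the axis powers of `z₁, z₂` are a
basis. `P₁`, `P₂` are monic equations for `z₂`, `z₁`, giving generation; the evaluations `e₁`, `e₂`
detect all coefficients, giving independence. -/
theorem isCohenMacaulay_of_evaluations {F : Type*} [CommRing F]
    {φ : MvPolynomial (Fin 4) K →+* F} (hφ : Function.Surjective φ)
    {f : Fin 3 → MvPolynomial (Fin 4) K} (hker : RingHom.ker φ = Ideal.span (Set.range f))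
    (p q : MvPolynomial (Fin 4) K) (h0 : X 0 = p ∨ X 0 = p + X 2) (h3 : X 3 = q ∨ X 3 = q + X 1)
    {k : ℕ} (hk : 0 < k)
    (e₁ e₂ : MvPolynomial (Fin 4) K →ₐ[K] Polynomial (MvPolynomial (Fin 2) K))
    (hp₁ : e₁ p = Polynomial.C (X 0)) (hq₁ : e₁ q = Polynomial.C (X 1))
    (hp₂ : e₂ p = Polynomial.C (X 0)) (hq₂ : e₂ q = Polynomial.C (X 1))
    {α : MvPolynomial (Fin 2) K} (hs₁ : e₁ (X 1) = Polynomial.C α) (ht₁ : e₁ (X 2) = Polynomial.X)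
    (hs₂ : e₂ (X 1) = Polynomial.X) {P₁ P₂ : Polynomial (MvPolynomial (Fin 2) K)}
    (hP₁ : P₁.Monic) (hP₂ : P₂.Monic) (hd₁ : P₁.natDegree = k) (hd₂ : P₂.natDegree = k)
    (hf₁ : ∀ i, P₁ ∣ e₁ (f i)) (hf₂ : ∀ i, P₂ ∣ e₂ (f i))
    (hst : ∃ x y z : MvPolynomial (Fin 2) K, X 1 * X 2 - (aeval ![p, q] x + aeval ![p, q] y * X 1 +
      aeval ![p, q] z * X 2) ∈ Ideal.span (Set.range f))
    (ht : Polynomial.eval₂ (aeval (R := K) ![p, q]).toRingHom (X 2) P₁ ∈ Ideal.span (Set.range f))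
    (hs : Polynomial.eval₂ (aeval (R := K) ![p, q]).toRingHom (X 1) P₂ ∈
      Ideal.span (Set.range f)) :
    IsCohenMacaulay F := by
  let ψ : MvPolynomial (Fin 2) K →ₐ[K] MvPolynomial (Fin 4) K := aeval ![p, q]
  let _ : Algebra (MvPolynomial (Fin 2) K) F := (φ.comp ψ.toRingHom).toAlgebra
  have hψ : ∀ a, φ (ψ a) = algebraMap (MvPolynomial (Fin 2) K) F a := fun _ ↦ rfl
  have hφf : ∀ g ∈ Ideal.span (Set.range f), φ g = 0 := fun g hg ↦ by
    rwa [← hker] at hg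
  have hdvd : ∀ (e : MvPolynomial (Fin 4) K →ₐ[K] Polynomial (MvPolynomial (Fin 2) K)) P,
      (∀ i, P ∣ e (f i)) → ∀ g, φ g = 0 → P ∣ e g := by
    intro e P h g hg
    rw [← RingHom.mem_ker, hker] at hg
    obtain ⟨c, rfl⟩ := Ideal.mem_span_range_iff_exists_fun.mp hg
    rw [map_sum]
    exact Finset.dvd_sum fun i _ ↦ by rw [map_mul]; exact (h i).mul_left _
  have hconst : ∀ e : MvPolynomial (Fin 4) K →ₐ[K] Polynomial (MvPolynomial (Fin 2) K),
      e p = Polynomial.C (X 0) → e q = Polynomial.C (X 1) → ∀ a, e (ψ a) = Polynomial.C a := by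
    intro e hp hq a
    have : e.comp ψ = Polynomial.CAlgHom := by
      apply MvPolynomial.algHom_ext
      intro i
      fin_cases i <;> simp [ψ, hp, hq]
    exact DFunLike.congr_fun this a
  have heval : ∀ (P : Polynomial (MvPolynomial (Fin 2) K)) x,
      Polynomial.eval₂ ψ.toRingHom x P ∈ Ideal.span (Set.range f) →
      Polynomial.aeval (φ x) P = 0 := by
    intro P x hx
    rw [Polynomial.aeval_def, ← hφf _ hx, Polynomial.hom_eval₂]
    rfl
  obtain ⟨x, y, z, hxyz⟩ := hst
  have hxyz' : φ (X 1) * φ (X 2) = algebraMap (MvPolynomial (Fin 2) K) F x +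
      algebraMap (MvPolynomial (Fin 2) K) F y * φ (X 1) +
      algebraMap (MvPolynomial (Fin 2) K) F z * φ (X 2) := by
    have := hφf _ hxyz
    rwa [map_sub, map_add, map_add, map_mul, map_mul, map_mul, sub_eq_zero] at this
  refine isCohenMacaulay_of_linearIndependent_axisPowers hk hxyz' ?_ ?_ ?_ ?_
  · have := pow_mem_span_of_monic hP₂ (heval _ _ hs)
      (M := Submodule.span _ (Set.range (axisPowers (φ (X 1)) (φ (X 2)) k)))
      fun r hr ↦ pow_left_mem_span_axisPowers (hd₂ ▸ hr)
    rwa [hd₂] at this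
  · have := pow_mem_span_of_monic hP₁ (heval _ _ ht)
      (M := Submodule.span _ (Set.range (axisPowers (φ (X 1)) (φ (X 2)) k)))
      fun r hr ↦ pow_right_mem_span_axisPowers (hd₁ ▸ hr)
    rwa [hd₁] at this
  · exact adjoin_eq_top_of_X_mem hφ (ψ := ψ.toRingHom) hψ
      (fun c ↦ ⟨C c, by simp [ψ]⟩) (x₀ := X 0) (x₃ := X 1)
      (by simpa [ψ] using h0) (by simpa [ψ] using h3)
  · exact linearIndependent_axisPowers φ ψ.toRingHom hψ (e₁ := e₁.toRingHom) (e₂ := e₂.toRingHom)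
      (hconst e₁ hp₁ hq₁) (hconst e₂ hp₂ hq₂) hs₁ ht₁ hs₂ hP₁ hP₂ hd₁ hd₂ hk
      (hdvd e₁ P₁ hf₁) (hdvd e₂ P₂ hf₂)

theorem isCohenMacaulay_of_ker_eq_span_above {F : Type*} [CommRing F]
    {φ : MvPolynomial (Fin 4) K →+* F} (hφ : Function.Surjective φ) {k : ℕ} (hk : 0 < k)
    (hker : RingHom.ker φ = Ideal.span (Set.range ![X 1 * X 2, X 1 ^ k, X 2 ^ k])) :
    IsCohenMacaulay F := by
  have hmem : ∀ i : Fin 3, (![X 1 * X 2, X 1 ^ k, X 2 ^ k] : Fin 3 → MvPolynomial (Fin 4) K) i ∈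
    Ideal.span (Set.range ![X 1 * X 2, X 1 ^ k, X 2 ^ k]) := fun i ↦ Ideal.subset_span ⟨i, rfl⟩
  refine isCohenMacaulay_of_evaluations hφ hker (X 0) (X 3) (Or.inl rfl) (Or.inl rfl) hk
    -- The two evaluations set `z₁ = 0` and `z₂ = 0` respectively.
    (aeval ![Polynomial.C (X 0), 0, Polynomial.X, Polynomial.C (X 1)])
    (aeval ![Polynomial.C (X 0), Polynomial.X, 0, Polynomial.C (X 1)])
    (by simp) (by simp) (by simp) (by simp) (α := 0) (by simp) (by simp) (by simp)
    (P₁ := Polynomial.X ^ k) (P₂ := Polynomial.X ^ k)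
    (Polynomial.monic_X_pow k) (Polynomial.monic_X_pow k) (by simp) (by simp) ?_ ?_
    ⟨0, 0, 0, by simpa using hmem 0⟩ (by simpa using hmem 2) (by simpa using hmem 1)
  · intro i
    fin_cases i <;> simp [hk.ne']
  · intro i
    fin_cases i <;> simp [hk.ne']

theorem isCohenMacaulay_of_ker_eq_span_below {F : Type*} [CommRing F]
    {φ : MvPolynomial (Fin 4) K →+* F} (hφ : Function.Surjective φ) {i l : ℕ} (hi : 0 < i)
    (hker : RingHom.ker φ =
      Ideal.span (Set.range ![X 0 * X 3, X 3 ^ i * X 1 ^ l, X 0 ^ i * X 2 ^ l])) :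
    IsCohenMacaulay F := by
  have hmem : ∀ j : Fin 3, (![X 0 * X 3, X 3 ^ i * X 1 ^ l, X 0 ^ i * X 2 ^ l] :
      Fin 3 → MvPolynomial (Fin 4) K) j ∈
    Ideal.span (Set.range ![X 0 * X 3, X 3 ^ i * X 1 ^ l, X 0 ^ i * X 2 ^ l]) := fun j ↦
      Ideal.subset_span ⟨j, rfl⟩
  have hmonic : ∀ z : MvPolynomial (Fin 2) K,
      ((Polynomial.X + Polynomial.C z) ^ i * Polynomial.X ^ l).Monic := fun z ↦
    ((Polynomial.monic_X_add_C z).pow i).mul (Polynomial.monic_X_pow l)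
  have hdeg : ∀ z : MvPolynomial (Fin 2) K,
      ((Polynomial.X + Polynomial.C z) ^ i * Polynomial.X ^ l).natDegree = i + l := fun z ↦ by
    rw [((Polynomial.monic_X_add_C z).pow i).natDegree_mul (Polynomial.monic_X_pow l),
      (Polynomial.monic_X_add_C z).natDegree_pow]
    simp
  refine isCohenMacaulay_of_evaluations hφ hker (X 0 - X 2) (X 3 - X 1) (Or.inr (by ring))
    (Or.inr (by ring)) (k := i + l) (by omega)
    -- The two evaluations set `z₃ = 0` and `z₀ = 0`; the remaining values are fixed by `z₀ - z₂ =
    -- x` and `z₃ - z₁ = y`.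
    (aeval ![Polynomial.X + Polynomial.C (X 0), Polynomial.C (-X 1), Polynomial.X, 0])
    (aeval ![0, Polynomial.X, Polynomial.C (-X 0), Polynomial.X + Polynomial.C (X 1)])
    (by simp) (by simp) (by simp) (by simp) (α := - X 1) (by simp) (by simp) (by simp)
    (hmonic (X 0)) (hmonic (X 1)) (hdeg _) (hdeg _) ?_ ?_
    -- These are the coefficients from expanding `z₀z₃ = (p + z₂)(q + z₁)`.
    ⟨- (X 0 * X 1), - X 0, - X 1, ?_⟩ ?_ ?_
  · intro j
    fin_cases j <;> simp [hi.ne']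
  · intro j
    fin_cases j <;> simp [hi.ne']
  · convert hmem 0 using 1
    simp
    ring
  · convert hmem 2 using 1
    simp [Polynomial.eval₂_add, Polynomial.eval₂_pow]
  · convert hmem 1 using 1
    simp [Polynomial.eval₂_add, Polynomial.eval₂_pow]

end ExpectedGenerators

section Cases

variable {K : Type*} [Field K] {a b c : ℕ}

theorem eq_of_coeff_middle_ne_zero {ν : Fin 2 →₀ ℕ} {m₀ m₁ m₂ m₃ : ℕ}
    (h : coeff ν (0 ^ m₀ * X 0 ^ m₁ * X 1 ^ m₂ * 0 ^ m₃ : MvPolynomial (Fin 2) K) ≠ 0) :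
    m₀ = 0 ∧ m₁ = ν 0 ∧ m₂ = ν 1 ∧ m₃ = 0 := by
  have h0 : m₀ = 0 := by
    by_contra h0
    exact h (by rw [zero_pow h0]; simp)
  have h3 : m₃ = 0 := by
    by_contra h3
    exact h (by rw [zero_pow h3]; simp)
  subst h0 h3
  rw [pow_zero, one_mul, mul_one] at h
  obtain ⟨h1, h2⟩ := eq_of_coeff_X_pow_mul_X_pow_ne_zero h
  exact ⟨rfl, h1.symm, h2.symm, rfl⟩

theorem eq_of_coeff_outer_ne_zero {ν : Fin 2 →₀ ℕ} {m₀ m₁ m₂ m₃ : ℕ}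
    (h : coeff ν (X 0 ^ m₀ * 0 ^ m₁ * 0 ^ m₂ * X 1 ^ m₃ : MvPolynomial (Fin 2) K) ≠ 0) :
    m₀ = ν 0 ∧ m₁ = 0 ∧ m₂ = 0 ∧ m₃ = ν 1 := by
  have h1 : m₁ = 0 := by
    by_contra h1
    exact h (by rw [zero_pow h1]; simp)
  have h2 : m₂ = 0 := by
    by_contra h2
    exact h (by rw [zero_pow h2]; simp)
  subst h1 h2
  rw [pow_zero, mul_one, mul_one] at h
  obtain ⟨h1, h2⟩ := eq_of_coeff_X_pow_mul_X_pow_ne_zero h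
  exact ⟨h1.symm, rfl, rfl, h2.symm⟩

theorem eq_of_coeff_folded_ne_zero {ν : Fin 2 →₀ ℕ} {m₀ m₁ m₂ m₃ : ℕ}
    (h : coeff ν (X 1 ^ m₀ * X 0 ^ m₁ * X 1 ^ m₂ * X 0 ^ m₃ : MvPolynomial (Fin 2) K) ≠ 0) :
    m₀ + m₂ = ν 1 ∧ m₁ + m₃ = ν 0 := by
  have : (X 1 ^ m₀ * X 0 ^ m₁ * X 1 ^ m₂ * X 0 ^ m₃ : MvPolynomial (Fin 2) K) =
      X 0 ^ (m₁ + m₃) * X 1 ^ (m₀ + m₂) := by ring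
  rw [this] at h
  obtain ⟨h1, h2⟩ := eq_of_coeff_X_pow_mul_X_pow_ne_zero h
  exact ⟨h2.symm, h1.symm⟩

theorem coeff_single_aeval_middle_eq_zero {J : Ideal (MvPolynomial (Fin 4) K)} {k : ℕ}
    (hJ : ∀ g ∈ J, ∀ m : Fin 4 →₀ ℕ, m 0 = 0 → m 3 = 0 →
      (m 1 < k ∧ m 2 = 0 ∨ m 1 = 0 ∧ m 2 < k) → coeff m g = 0) :
    ∀ g ∈ J, ∀ i, ∀ r < k,
      coeff (Finsupp.single i r) (aeval (![0, X 0, X 1, 0] : Fin 4 → MvPolynomial (Fin 2) K) g) =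
        0 := by
  intro g hg i r hr
  refine coeff_aeval_eq_zero fun m hm ↦ ?_
  obtain ⟨h0, h1, h2, h3⟩ := eq_of_coeff_middle_ne_zero hm
  refine hJ g hg m h0 h3 ?_
  fin_cases i
  · exact Or.inl ⟨by simpa [h1] using hr, by simp [h2]⟩
  · exact Or.inr ⟨by simp [h1], by simpa [h2] using hr⟩

/-! ### The case `c < a + b` -/

section Above

/-- Each factor `u₁` or `u₄` would make the total degree smaller than that of `u₂ ^ r`, so only `u₂,
u₃` occur; then the exponent of `y` and `a < b` exclude `u₃`. -/
theorem eq_of_le_of_above (hab : a < b) (hc : c < a + b) {n₀ n₁ n₂ n₃ r : ℕ}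
    (hr : n₀ + n₁ + n₂ + n₃ = r) (hx : c * n₀ + b * n₁ + a * n₂ ≤ b * r)
    (hy : a * n₁ + b * n₂ + c * n₃ ≤ a * r)
    (hlt : ¬ c * n₀ + b * n₁ + a * n₂ + (a * n₁ + b * n₂ + c * n₃) < b * r + a * r) :
    n₀ = 0 ∧ n₁ = r ∧ n₂ = 0 ∧ n₃ = 0 := by
  subst hr
  have h03 : n₀ + n₃ = 0 := by
    by_contra h
    have := Nat.mul_lt_mul_of_pos_right hc (Nat.pos_of_ne_zero h)
    nlinarith
  obtain ⟨rfl, rfl⟩ : n₀ = 0 ∧ n₃ = 0 := by omega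
  have h2 : n₂ = 0 := by
    by_contra h
    have := Nat.mul_lt_mul_of_pos_right hab (Nat.pos_of_ne_zero h)
    nlinarith
  omega

/-- If `(b, a)` lies above the segment from `(c, 0)` to `(0, c)`, the conditions are equivalent. -/
theorem tfae_of_lt_add (hab : a < b) (hbc : b < c) (hc : c < a + b)
    {F : Type*} [CommRing F] {φ : MvPolynomial (Fin 4) K →+* F} (hφ : Function.Surjective φ)
    (hker : RingHom.ker φ = symmetricDefiningIdeal K a b c) :
    List.TFAE [IsCohenMacaulay F, (symmetricDefiningIdeal K a b c).spanFinrank ≤ 3,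
      (symmetricDefiningIdeal K a b c).spanFinrank = 3] := by
  classical
  -- `P k` says that `z₁ ^ k` (by symmetry, `z₂ ^ k`) vanishes in the fiber cone; the least such `k`
  -- is the exponent of the reduction.
  let P : ℕ → Prop := fun k ↦ ∃ n₀ n₁ n₂ n₃ : ℕ, n₀ + n₁ + n₂ + n₃ = k ∧
    c * n₀ + b * n₁ + a * n₂ ≤ b * k ∧ a * n₁ + b * n₂ + c * n₃ ≤ a * k ∧
    c * n₀ + b * n₁ + a * n₂ + (a * n₁ + b * n₂ + c * n₃) < b * k + a * k
  have hP : ∃ k, P k := by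
    -- `u₁ ^ b * u₄ ^ (c - b)` properly divides `u₂ ^ c`: the exponents of `x` agree, and `c - b <
    -- a`.
    refine ⟨c, b, 0, 0, c - b, by omega, by nlinarith, ?_, ?_⟩
    · obtain ⟨d, rfl⟩ := Nat.exists_eq_add_of_lt hbc
      have : b + d + 1 - b = d + 1 := by omega
      rw [this]
      nlinarith
    · obtain ⟨d, rfl⟩ := Nat.exists_eq_add_of_lt hbc
      have : b + d + 1 - b = d + 1 := by omega
      rw [this]
      nlinarith
  set k := Nat.find hP
  have hk : P k := Nat.find_spec hP
  have hmin : ∀ r < k, ¬ P r := fun r hr ↦ Nat.find_min hP hr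
  have hk2 : 2 ≤ k := by
    by_contra hlt
    obtain ⟨n₀, n₁, n₂, n₃, hn, hx, hy, hl⟩ := hk
    have h1 : k = 0 ∨ k = 1 := by omega
    rcases h1 with h1 | h1
    · rw [h1] at hl; omega
    · rw [h1] at hn hx hy hl
      have : n₀ = 1 ∧ n₁ = 0 ∧ n₂ = 0 ∧ n₃ = 0 ∨ n₀ = 0 ∧ n₁ = 1 ∧ n₂ = 0 ∧ n₃ = 0 ∨
          n₀ = 0 ∧ n₁ = 0 ∧ n₂ = 1 ∧ n₃ = 0 ∨ n₀ = 0 ∧ n₁ = 0 ∧ n₂ = 0 ∧ n₃ = 1 := by omega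
      rcases this with ⟨rfl, rfl, rfl, rfl⟩ | ⟨rfl, rfl, rfl, rfl⟩ | ⟨rfl, rfl, rfl, rfl⟩ |
        ⟨rfl, rfl, rfl, rfl⟩ <;> omega
  have hmid : ∀ g ∈ symmetricDefiningIdeal K a b c, ∀ m : Fin 4 →₀ ℕ, m 0 = 0 → m 3 = 0 →
      (m 1 < k ∧ m 2 = 0 ∨ m 1 = 0 ∧ m 2 < k) → coeff m g = 0 := by
    intro g hg m h0 h3 h
    refine coeff_eq_zero_of_mem_symmetricDefiningIdeal hg fun n₀ n₁ n₂ n₃ hn hx hy ↦ ?_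
    rcases h with ⟨h1, h2⟩ | ⟨h1, h2⟩
    · simp only [h0, h2, h3, mul_zero, add_zero, zero_add] at hn hx hy ⊢
      exact eq_of_le_of_above hab hc hn hx hy fun hl ↦ hmin _ h1 ⟨n₀, n₁, n₂, n₃, hn, hx, hy, hl⟩
    · simp only [h0, h1, h3, mul_zero, add_zero, zero_add] at hn hx hy ⊢
      have := eq_of_le_of_above hab hc (n₀ := n₃) (n₁ := n₂) (n₂ := n₁) (n₃ := n₀) (r := m 2)
        (by omega) (by omega) (by omega) fun hl ↦ hmin _ h2
          ⟨n₃, n₂, n₁, n₀, by omega, by omega, by omega, hl⟩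
      tauto
  have hred : PlaneReduction (symmetricDefiningIdeal K a b c) k (X 0) (X 3)
      (aeval ![0, X 0, X 1, 0]) ![X 1 * X 2, X 1 ^ k, X 2 ^ k] := by
    refine planeReduction_of_coeff_eq_zero rfl rfl (fun i ↦ by fin_cases i <;> simp) hk2
      (isHomogeneous_X K 0) (isHomogeneous_X K 3) (by simp) (by simp) ?_ ?_ ?_
      (coeff_single_aeval_middle_eq_zero hmid)
    · obtain ⟨n₀, n₁, n₂, n₃, hn, hx, hy, hl⟩ := hk
      intro i
      fin_cases i
      · have := quadMonomial_mem_symmetricDefiningIdeal (K := K) (a := a) (b := b) (c := c)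
          (n₀ := 1) (n₁ := 0) (n₂ := 0) (n₃ := 1) (m₀ := 0) (m₁ := 1) (m₂ := 1) (m₃ := 0)
          rfl (by omega) (by omega) (by omega)
        simpa [quadMonomial] using this
      · have := quadMonomial_mem_symmetricDefiningIdeal (K := K) (a := a) (b := b) (c := c)
          (n₀ := n₀) (n₁ := n₁) (n₂ := n₂) (n₃ := n₃) (m₀ := 0) (m₁ := k) (m₂ := 0) (m₃ := 0)
          (by omega) (by omega) (by omega) (by omega)
        simpa [quadMonomial] using this
      · have := quadMonomial_mem_symmetricDefiningIdeal (K := K) (a := a) (b := b) (c := c)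
          (n₀ := n₃) (n₁ := n₂) (n₂ := n₁) (n₃ := n₀) (m₀ := 0) (m₁ := 0) (m₂ := k) (m₃ := 0)
          (by omega) (by omega) (by omega) (by omega)
        simpa [quadMonomial] using this
    · intro i
      fin_cases i
      · exact ⟨_, (isHomogeneous_X K 1).mul (isHomogeneous_X K 2)⟩
      · exact ⟨_, isHomogeneous_X_pow 1 k⟩
      · exact ⟨_, isHomogeneous_X_pow 2 k⟩
    · intro i
      fin_cases i <;> simp [planeGenerators]
  -- The fiber cone maps onto `K[z₀, z₃]`, since no monomial in `z₀, z₃` occurs in an element of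
  -- `J`; this gives dimension at least two.
  refine hred.tfae hφ hker (v := ![X 0, 0, 0, X 1]) (fun i ↦ by fin_cases i <;> simp) one_pos
    (i := 0) (j := 3) (by simp) (by simp) ?_ fun hJ ↦
      isCohenMacaulay_of_ker_eq_span_above hφ (by omega) (hker.trans hJ)
  intro g hg
  ext ν
  refine coeff_aeval_eq_zero fun m hm ↦ ?_
  obtain ⟨-, h1, h2, -⟩ := eq_of_coeff_outer_ne_zero hm
  refine coeff_eq_zero_of_mem_symmetricDefiningIdeal hg fun n₀ n₁ n₂ n₃ hn hx hy ↦ ?_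
  simp only [h1, h2, mul_zero, add_zero, zero_add] at hn hx hy ⊢
  have h12 : n₁ + n₂ = 0 := by
    by_contra h
    have := Nat.mul_lt_mul_of_pos_right hc (Nat.pos_of_ne_zero h)
    nlinarith
  obtain ⟨rfl, rfl⟩ : n₁ = 0 ∧ n₂ = 0 := by omega
  have h0 : n₀ ≤ m 0 := Nat.le_of_mul_le_mul_left (by simpa using hx) (by omega : 0 < c)
  have h3 : n₃ ≤ m 3 := Nat.le_of_mul_le_mul_left (by simpa using hy) (by omega : 0 < c)
  omega

end Above

/-! ### The case `a + b < c` -/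

section Below

/-- A divisor of `u₁ ^ i * u₃ ^ l` must have the same total degree, whence `n₀ + n₃ = i` and `n₁ +
n₂ = l`. After cancellation `u₁ ^ n₃ * u₃ ^ n₁ = u₂ ^ n₁ * u₄ ^ n₃`, and a nontrivial such identity
produces a proper divisibility in no larger degree. -/
theorem eq_of_le_of_below (hab : a < b) (hbc : b < c) (hc : a + b < c) {i l n₀ n₁ n₂ n₃ : ℕ}
    (hn : n₀ + n₁ + n₂ + n₃ = i + l) (hx : c * n₀ + b * n₁ + a * n₂ ≤ c * i + a * l)
    (hy : a * n₁ + b * n₂ + c * n₃ ≤ b * l)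
    (hlt : ∀ i' l', i' + l' ≤ i + l → ¬ ∃ n₀ n₁ n₂ n₃ : ℕ, n₀ + n₁ + n₂ + n₃ = i' + l' ∧
      c * n₀ + b * n₁ + a * n₂ ≤ c * i' + a * l' ∧ a * n₁ + b * n₂ + c * n₃ ≤ b * l' ∧
      c * n₀ + b * n₁ + a * n₂ + (a * n₁ + b * n₂ + c * n₃) < c * i' + a * l' + b * l') :
    n₀ = i ∧ n₁ = 0 ∧ n₂ = l ∧ n₃ = 0 := by
  have hl : ¬ c * n₀ + b * n₁ + a * n₂ + (a * n₁ + b * n₂ + c * n₃) < c * i + a * l + b * l :=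
    fun h ↦ hlt i l le_rfl ⟨_, _, _, _, hn, hx, hy, h⟩
  obtain ⟨e, he⟩ := Nat.exists_eq_add_of_lt hc
  have h03 : (e + 1) * (n₀ + n₃) = (e + 1) * i := by
    have : c * (n₀ + n₃) + (a + b) * (n₁ + n₂) = c * i + (a + b) * l := by nlinarith
    have h2 : (a + b) * (n₀ + n₃) + (a + b) * (n₁ + n₂) = (a + b) * i + (a + b) * l := by
      rw [← mul_add, ← mul_add]; congr 1; omega
    subst he
    nlinarith
  have h03' : n₀ + n₃ = i := Nat.eq_of_mul_eq_mul_left (Nat.succ_pos e) h03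
  obtain rfl : l = n₁ + n₂ := by omega
  subst h03'
  obtain ⟨d, rfl⟩ := Nat.exists_eq_add_of_lt hab
  have hdn : (d + 1) * n₁ = c * n₃ := by nlinarith
  have h3 : n₃ = 0 := by
    by_contra h3
    have h13 : n₃ ≤ n₁ := by
      by_contra h
      have : (d + 1) * n₁ < c * n₃ := Nat.mul_lt_mul'' (by omega) (by omega)
      omega
    obtain ⟨t, rfl⟩ := Nat.exists_eq_add_of_le h13
    have hpos : 0 < n₃ := Nat.pos_of_ne_zero h3
    have hcn := Nat.mul_lt_mul_of_pos_right hc hpos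
    -- Multiply the identity by `u₁ ^ n₃`, replace `u₁u₄` by its proper divisor `u₂u₃`, and cancel
    -- `u₃ ^ n₃`: thus `u₂ ^ (2n₃ + t)` properly divides `u₁ ^ (2n₃) * u₃ ^ t`.
    refine hlt (2 * n₃) t (by omega) ⟨0, 2 * n₃ + t, 0, 0, by omega, ?_, ?_, ?_⟩ <;> nlinarith
  subst h3
  have h1 : n₁ = 0 := by
    rcases Nat.mul_eq_zero.mp (hdn.trans (mul_zero c)) with h | h
    · omega
    · exact h
  omega

/-- If `(b, a)` lies below the segment from `(c, 0)` to `(0, c)`, the conditions are equivalent. -/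
theorem tfae_of_add_lt (ha : 0 < a) (hab : a < b) (hbc : b < c) (hc : a + b < c)
    {F : Type*} [CommRing F] {φ : MvPolynomial (Fin 4) K →+* F} (hφ : Function.Surjective φ)
    (hker : RingHom.ker φ = symmetricDefiningIdeal K a b c) :
    List.TFAE [IsCohenMacaulay F, (symmetricDefiningIdeal K a b c).spanFinrank ≤ 3,
      (symmetricDefiningIdeal K a b c).spanFinrank = 3] := by
  classical
  let Q : ℕ → ℕ → Prop := fun i l ↦ ∃ n₀ n₁ n₂ n₃ : ℕ, n₀ + n₁ + n₂ + n₃ = i + l ∧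
    c * n₀ + b * n₁ + a * n₂ ≤ c * i + a * l ∧ a * n₁ + b * n₂ + c * n₃ ≤ b * l ∧
    c * n₀ + b * n₁ + a * n₂ + (a * n₁ + b * n₂ + c * n₃) < c * i + a * l + b * l
  have hP : ∃ k, ∃ i l, i + l = k ∧ Q i l := by
    obtain ⟨d, rfl⟩ := Nat.exists_eq_add_of_lt hab
    obtain ⟨e, rfl⟩ := Nat.exists_eq_add_of_lt hc
    -- Here `i = 2(b - a)` and `l = c - (b - a)`. Compared with `u₂ ^ (i + l)`, both exponents of
    -- `u₁ ^ i * u₃ ^ l` are larger by `(b - a)(c - a - b)`.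
    refine ⟨_, 2 * (d + 1), a + (a + e + 1), rfl, 0, 2 * (d + 1) + (a + (a + e + 1)), 0, 0,
      by omega, ?_, ?_, ?_⟩ <;> nlinarith
  obtain ⟨i, l, hil, hQ⟩ := Nat.find_spec hP
  have hmin : ∀ i' l', i' + l' < i + l → ¬ Q i' l' := fun i' l' h h' ↦
    Nat.find_min hP (hil ▸ h) ⟨i', l', rfl, h'⟩
  clear hil
  -- Both exponents are positive: `u₃ ^ l` has the least total degree among products of `l`
  -- generators, and `u₁ ^ i` is the only product of `i` generators free of `y`.
  have hi : 0 < i := by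
    by_contra h
    obtain rfl : i = 0 := by omega
    obtain ⟨n₀, n₁, n₂, n₃, hn, hx, hy, hl⟩ := hQ
    obtain rfl : n₀ + n₁ + n₂ + n₃ = l := by omega
    have : (a + b) * (n₀ + n₃) ≤ c * (n₀ + n₃) := Nat.mul_le_mul_right _ hc.le
    nlinarith
  have hl0 : 0 < l := by
    by_contra h
    obtain rfl : l = 0 := by omega
    obtain ⟨n₀, n₁, n₂, n₃, hn, hx, hy, hl⟩ := hQ
    have h1 : n₁ = 0 := by
      by_contra h
      have := Nat.mul_pos ha (Nat.pos_of_ne_zero h)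
      omega
    have h2 : n₂ = 0 := by
      by_contra h
      have := Nat.mul_pos (by omega : 0 < b) (Nat.pos_of_ne_zero h)
      omega
    have h3 : n₃ = 0 := by
      by_contra h
      have := Nat.mul_pos (by omega : 0 < c) (Nat.pos_of_ne_zero h)
      omega
    subst h1 h2 h3
    obtain rfl : n₀ = i := by omega
    omega
  -- Since `z₀z₃` is in `J` and `z₁, z₂` are independent modulo `J`, the variables are folded by `z₀
  -- = z₂`, `z₃ = z₁`. A pure power then collects monomials in `z₁, z₃` or in `z₀, z₂`, none of
  -- which occurs in `J` below degree `i + l`.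
  have hred : PlaneReduction (symmetricDefiningIdeal K a b c) (i + l) (X 0 - X 2) (X 3 - X 1)
      (aeval ![X 1, X 0, X 1, X 0]) ![X 0 * X 3, X 3 ^ i * X 1 ^ l, X 0 ^ i * X 2 ^ l] := by
    refine planeReduction_of_coeff_eq_zero rfl rfl (fun i ↦ by fin_cases i <;> simp) (by omega)
      ((isHomogeneous_X K 0).sub (isHomogeneous_X K 2))
      ((isHomogeneous_X K 3).sub (isHomogeneous_X K 1)) (by simp) (by simp) ?_ ?_ ?_ ?_
    · obtain ⟨n₀, n₁, n₂, n₃, hn, hx, hy, hl⟩ := hQ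
      intro j
      fin_cases j
      · have := quadMonomial_mem_symmetricDefiningIdeal (K := K) (a := a) (b := b) (c := c)
          (n₀ := 0) (n₁ := 1) (n₂ := 1) (n₃ := 0) (m₀ := 1) (m₁ := 0) (m₂ := 0) (m₃ := 1)
          rfl (by omega) (by omega) (by omega)
        simpa [quadMonomial] using this
      · have := quadMonomial_mem_symmetricDefiningIdeal (K := K) (a := a) (b := b) (c := c)
          (n₀ := n₃) (n₁ := n₂) (n₂ := n₁) (n₃ := n₀) (m₀ := 0) (m₁ := l) (m₂ := 0) (m₃ := i)
          (by omega) (by omega) (by omega) (by omega)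
        simpa [quadMonomial, mul_comm] using this
      · have := quadMonomial_mem_symmetricDefiningIdeal (K := K) (a := a) (b := b) (c := c)
          (n₀ := n₀) (n₁ := n₁) (n₂ := n₂) (n₃ := n₃) (m₀ := i) (m₁ := 0) (m₂ := l) (m₃ := 0)
          (by omega) (by omega) (by omega) (by omega)
        simpa [quadMonomial] using this
    · intro j
      fin_cases j
      · exact ⟨_, (isHomogeneous_X K 0).mul (isHomogeneous_X K 3)⟩
      · exact ⟨_, (isHomogeneous_X_pow 3 i).mul (isHomogeneous_X_pow 1 l)⟩
      · exact ⟨_, (isHomogeneous_X_pow 0 i).mul (isHomogeneous_X_pow 2 l)⟩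
    · intro j
      fin_cases j <;> simp [planeGenerators, pow_add, mul_comm]
    · intro g hg j r hr
      refine coeff_aeval_eq_zero fun m hm ↦ ?_
      obtain ⟨h1, h0⟩ := eq_of_coeff_folded_ne_zero hm
      refine coeff_eq_zero_of_mem_symmetricDefiningIdeal hg fun n₀ n₁ n₂ n₃ hn hx hy ↦ ?_
      fin_cases j
      · obtain ⟨h2, h4⟩ : m 0 = 0 ∧ m 2 = 0 := by simpa using h1
        have hr' : m 1 + m 3 = r := by simpa using h0
        simp only [h2, h4, mul_zero, add_zero, zero_add] at hn hx hy ⊢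
        have := eq_of_le_of_below hab hbc hc (n₀ := n₃) (n₁ := n₂) (n₂ := n₁) (n₃ := n₀)
          (i := m 3) (l := m 1) (by omega) (by omega) (by omega)
          fun i' l' h ↦ hmin i' l' (by omega)
        tauto
      · obtain ⟨h2, h4⟩ : m 1 = 0 ∧ m 3 = 0 := by simpa using h0
        have hr' : m 0 + m 2 = r := by simpa using h1
        simp only [h2, h4, mul_zero, add_zero, zero_add] at hn hx hy ⊢
        exact eq_of_le_of_below hab hbc hc hn hx hy fun i' l' h ↦ hmin i' l' (by omega)
  refine hred.tfae hφ hker (v := ![0, X 0, X 1, 0]) (fun i ↦ by fin_cases i <;> simp) one_pos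
    (i := 1) (j := 2) (by simp) (by simp) ?_ fun hJ ↦
      isCohenMacaulay_of_ker_eq_span_below hφ hi (hker.trans hJ)
  intro g hg
  ext ν
  refine coeff_aeval_eq_zero fun m hm ↦ ?_
  obtain ⟨h0, -, -, h3⟩ := eq_of_coeff_middle_ne_zero hm
  refine coeff_eq_zero_of_mem_symmetricDefiningIdeal hg fun n₀ n₁ n₂ n₃ hn hx hy ↦ ?_
  simp only [h0, h3, mul_zero, add_zero, zero_add] at hn hx hy ⊢
  have h03 : n₀ + n₃ = 0 := by
    by_contra h
    have := Nat.mul_lt_mul_of_pos_right hc (Nat.pos_of_ne_zero h)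
    have h2 : (a + b) * (n₀ + n₃) + (a + b) * (n₁ + n₂) = (a + b) * (m 1 + m 2) := by
      rw [← mul_add]; congr 1; omega
    nlinarith
  obtain ⟨rfl, rfl⟩ : n₀ = 0 ∧ n₃ = 0 := by omega
  have h1 : n₁ = m 1 := by
    obtain ⟨d, rfl⟩ := Nat.exists_eq_add_of_lt hab
    have h2 : a * n₁ + a * n₂ = a * m 1 + a * m 2 := by
      rw [← mul_add, ← mul_add]; congr 1; omega
    have h3 : (d + 1) * n₁ ≤ (d + 1) * m 1 := by nlinarith
    have h4 : (d + 1) * n₂ ≤ (d + 1) * m 2 := by nlinarith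
    have := Nat.le_of_mul_le_mul_left h3 (Nat.succ_pos d)
    have := Nat.le_of_mul_le_mul_left h4 (Nat.succ_pos d)
    omega
  omega

end Below

end Cases

/-! ### The case `c = a + b`: projective monomial curves -/

section ProjectiveCurve

variable {K : Type*} [Field K] {a b c : ℕ}

/-- If the generators of the ideal have the same degree, then the relations of the fiber cone are
relations between the generators. -/
theorem aeval_eq_zero_of_mem_symmetricDefiningIdeal (hc : a + b = c) {g : MvPolynomial (Fin 4) K}
    (hg : g ∈ symmetricDefiningIdeal K a b c) : aeval (symmetricGenerators K a b c) g = 0 := by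
  rw [← sum_homogeneousComponent g, map_sum]
  refine Finset.sum_eq_zero fun j _ ↦ ?_
  have hu : ∀ i, (symmetricGenerators K a b c i).IsHomogeneous c := by
    intro i
    rw [symmetricGenerators_eq_monomial]
    refine isHomogeneous_monomial 1 ?_
    fin_cases i <;> simp [symmetricExponents] <;> omega
  have hom := (homogeneousComponent_isHomogeneous j g).aeval _ hu
  ext μ
  by_cases hμ : μ.degree = c * j
  · refine coeff_aeval_homogeneousComponent_eq_zero symmetricGenerators_eq_monomial hg
      fun m hm hlt ↦ hlt.ne ?_
    have h0 := Finsupp.le_def.mp hlt.le 0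
    have h1 := Finsupp.le_def.mp hlt.le 1
    rw [linearCombination_symmetricExponents_zero] at h0
    rw [linearCombination_symmetricExponents_one] at h1
    rw [Finsupp.degree_eq_sum, Fin.sum_univ_two, ← hm, degree_fin_four] at hμ
    have : c * m 0 + b * m 1 + a * m 2 + (a * m 1 + b * m 2 + c * m 3) = μ 0 + μ 1 := by
      rw [hμ, ← hc]; ring
    ext i
    fin_cases i
    · change Finsupp.linearCombination ℕ (symmetricExponents a b c) m 0 = μ 0
      rw [linearCombination_symmetricExponents_zero]
      omega
    · change Finsupp.linearCombination ℕ (symmetricExponents a b c) m 1 = μ 1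
      rw [linearCombination_symmetricExponents_one]
      omega
  · rw [hom.coeff_eq_zero hμ, coeff_zero]

/-- The inequalities combine to `a (n₀ + n₂) = b (n₂ + n₃)`; by coprimality `b` divides `n₀ + n₂ ≤ r
< b`, so both sides vanish. -/
theorem eq_of_le_of_add_eq (hb : 0 < b) (hcop : Nat.Coprime a b) (hc : a + b = c)
    {n₀ n₁ n₂ n₃ r : ℕ} (hrb : r < b) (hn : n₀ + n₁ + n₂ + n₃ = r)
    (hx : c * n₀ + b * n₁ + a * n₂ ≤ b * r) (hy : a * n₁ + b * n₂ + c * n₃ ≤ a * r) :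
    n₀ = 0 ∧ n₁ = r ∧ n₂ = 0 ∧ n₃ = 0 := by
  subst hn hc
  have h1 : a * (n₀ + n₂) = b * (n₂ + n₃) := by nlinarith
  have hdvd : b ∣ n₀ + n₂ := hcop.symm.dvd_of_dvd_mul_left ⟨_, h1⟩
  have h02 : n₀ + n₂ = 0 := Nat.eq_zero_of_dvd_of_lt hdvd (by omega)
  rw [h02, mul_zero] at h1
  rcases Nat.mul_eq_zero.mp h1.symm with h | h <;> omega

/-- Modulo `2a + 1` one has `a ≡ -(a + 1)`, a unit, so these exponents are unit multiples of
distinct integers in `[-a, a]`. -/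
theorem middle_exponents_injective (a : ℕ) :
    ∀ i j : Fin (a + 1) ⊕ Fin (a + 1 - 1),
      Sum.elim (fun r : Fin (a + 1) ↦ (a + 1) * (r : ℕ))
          (fun r : Fin (a + 1 - 1) ↦ a * ((r : ℕ) + 1)) i ≡
        Sum.elim (fun r : Fin (a + 1) ↦ (a + 1) * (r : ℕ))
          (fun r : Fin (a + 1 - 1) ↦ a * ((r : ℕ) + 1)) j [MOD 2 * a + 1] →
      i = j := by
  have hcop : (2 * a + 1).gcd (a + 1) = 1 :=
    Nat.isCoprime_iff_coprime.mp ⟨-1, 2, by push_cast; ring⟩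
  have hcop' : (2 * a + 1).gcd a = 1 :=
    Nat.isCoprime_iff_coprime.mp ⟨1, -2, by push_cast; ring⟩
  have hmix : ∀ (r : Fin (a + 1)) (r' : Fin (a + 1 - 1)),
      ¬ (a + 1) * (r : ℕ) ≡ a * ((r' : ℕ) + 1) [MOD 2 * a + 1] := by
    intro r r' h
    have h1 : (a + 1) * ((r : ℕ) + (r' + 1)) ≡ 0 [MOD 2 * a + 1] := by
      rw [mul_add]
      refine (h.add_right _).trans ?_
      rw [← add_mul]
      have : a + (a + 1) = 2 * a + 1 := by ring
      rw [this]
      simp [Nat.ModEq]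
    have h2 : 2 * a + 1 ∣ (r : ℕ) + (r' + 1) :=
      Nat.Coprime.dvd_of_dvd_mul_left hcop ((Nat.modEq_zero_iff_dvd).mp h1)
    have := Nat.le_of_dvd (by omega) h2
    omega
  rintro (r | r) (r' | r') h
  · have := (Nat.ModEq.cancel_left_of_coprime hcop h)
    have := Nat.ModEq.eq_of_lt_of_lt this (by omega) (by omega)
    rw [Fin.ext this]
  · exact absurd h (hmix r r')
  · exact absurd h.symm (hmix r' r)
  · have := (Nat.ModEq.cancel_left_of_coprime hcop' h)
    have := Nat.ModEq.eq_of_lt_of_lt this (by omega) (by omega)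
    rw [Fin.ext (Nat.succ_injective this)]

theorem monomial_single_add_single (p q : ℕ) :
    monomial (Finsupp.single 0 p + Finsupp.single 1 q) (1 : K) =
      (X 0 ^ p * X 1 ^ q : MvPolynomial (Fin 2) K) := by
  simp [X_pow_eq_monomial, monomial_mul]

/-- Over `K[z₀, z₃]` the relations `z₁z₂ = z₀z₃`, `z₁ ^ (a + 1) = z₀z₂ ^ a` and `z₂ ^ (a + 1) = z₃z₁
^ a` show that the axis powers generate. They are independent because the exponents of `x` in their
values are distinct modulo `c`. -/
theorem isCohenMacaulay_of_ker_eq_symmetricDefiningIdeal (ha : 0 < a) {F : Type*} [CommRing F]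
    {φ : MvPolynomial (Fin 4) K →+* F} (hφ : Function.Surjective φ)
    (hker : RingHom.ker φ = symmetricDefiningIdeal K a (a + 1) (2 * a + 1)) :
    IsCohenMacaulay F := by
  let ψ : MvPolynomial (Fin 2) K →ₐ[K] MvPolynomial (Fin 4) K := aeval ![X 0, X 3]
  let _ : Algebra (MvPolynomial (Fin 2) K) F := (φ.comp ψ.toRingHom).toAlgebra
  have hψ : ∀ a, φ (ψ a) = algebraMap (MvPolynomial (Fin 2) K) F a := fun _ ↦ rfl
  have hmem : ∀ {g h}, g - h ∈ symmetricDefiningIdeal K a (a + 1) (2 * a + 1) → φ g = φ h := by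
    intro g h hgh
    rwa [← hker, RingHom.mem_ker, map_sub, sub_eq_zero] at hgh
  have hst : φ (X 1) * φ (X 2) = algebraMap (MvPolynomial (Fin 2) K) F (X 0 * X 1) +
      algebraMap (MvPolynomial (Fin 2) K) F 0 * φ (X 1) +
      algebraMap (MvPolynomial (Fin 2) K) F 0 * φ (X 2) := by
    have := hmem (quadMonomial_sub_mem_symmetricDefiningIdeal (K := K) (a := a) (b := a + 1)
      (c := 2 * a + 1) (m₀ := 0) (m₁ := 1) (m₂ := 1) (m₃ := 0) (n₀ := 1) (n₁ := 0) (n₂ := 0)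
      (n₃ := 1) (by omega) (by ring) (by ring))
    simpa [← hψ, ψ, quadMonomial] using this
  have hs : φ (X 1) ^ (a + 1) = algebraMap (MvPolynomial (Fin 2) K) F (X 0) * φ (X 2) ^ a := by
    have := hmem (quadMonomial_sub_mem_symmetricDefiningIdeal (K := K) (a := a) (b := a + 1)
      (c := 2 * a + 1) (m₀ := 0) (m₁ := a + 1) (m₂ := 0) (m₃ := 0) (n₀ := 1) (n₁ := 0) (n₂ := a)
      (n₃ := 0) (by omega) (by ring) (by ring))
    simpa [← hψ, ψ, quadMonomial] using this
  have ht : φ (X 2) ^ (a + 1) = algebraMap (MvPolynomial (Fin 2) K) F (X 1) * φ (X 1) ^ a := by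
    have := hmem (quadMonomial_sub_mem_symmetricDefiningIdeal (K := K) (a := a) (b := a + 1)
      (c := 2 * a + 1) (m₀ := 0) (m₁ := 0) (m₂ := a + 1) (m₃ := 0) (n₀ := 0) (n₁ := a) (n₂ := 0)
      (n₃ := 1) (by omega) (by ring) (by ring))
    simpa [← hψ, ψ, quadMonomial, mul_comm] using this
  refine isCohenMacaulay_of_linearIndependent_axisPowers (Nat.succ_pos a) hst ?_ ?_ ?_ ?_
  · rw [hs, ← Algebra.smul_def]
    exact Submodule.smul_mem _ _ (pow_right_mem_span_axisPowers (Nat.lt_succ_self a))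
  · rw [ht, ← Algebra.smul_def]
    exact Submodule.smul_mem _ _ (pow_left_mem_span_axisPowers (Nat.lt_succ_self a))
  · exact adjoin_eq_top_of_X_mem hφ (ψ := ψ.toRingHom) hψ
      (fun c ↦ ⟨C c, by simp [ψ]⟩) (x₀ := X 0) (x₃ := X 1)
      (Or.inl (by simp [ψ])) (Or.inl (by simp [ψ]))
  · rw [Fintype.linearIndependent_iff]
    intro d hd
    have hg : ∑ i, ψ (d i) * axisPowers (X 1) (X 2) (a + 1) i ∈
        symmetricDefiningIdeal K a (a + 1) (2 * a + 1) := by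
      rw [← hker, RingHom.mem_ker, ← hd, map_sum]
      refine Finset.sum_congr rfl fun i _ ↦ ?_
      rw [map_mul, hψ, Algebra.smul_def]
      rcases i with i | i <;> simp [axisPowers]
    have h0 := aeval_eq_zero_of_mem_symmetricDefiningIdeal (by ring) hg
    have hexp : ∀ f, aeval (symmetricGenerators K a (a + 1) (2 * a + 1)) (ψ f) =
        expand (2 * a + 1) f := by
      intro f
      have : (aeval (symmetricGenerators K a (a + 1) (2 * a + 1))).comp ψ =
          expand (2 * a + 1) := by
        apply MvPolynomial.algHom_ext
        intro i
        fin_cases i <;> simp [ψ, symmetricGenerators]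
      exact DFunLike.congr_fun this f
    refine eq_zero_of_sum_expand_mul_monomial (c := 2 * a + 1) (by omega)
      (v := Sum.elim
        (fun r : Fin (a + 1) ↦ Finsupp.single 0 ((a + 1) * (r : ℕ)) +
          Finsupp.single 1 (a * (r : ℕ)))
        (fun r : Fin (a + 1 - 1) ↦ Finsupp.single 0 (a * ((r : ℕ) + 1)) +
          Finsupp.single 1 ((a + 1) * ((r : ℕ) + 1)))) ?_ ?_
    · intro i j hij
      refine middle_exponents_injective a i j ?_
      rcases i with i | i <;> rcases j with j | j <;> simpa using hij
    · rw [← h0, map_sum]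
      refine Finset.sum_congr rfl fun i _ ↦ ?_
      rw [map_mul, hexp]
      congr 1
      rcases i with i | i
      · rw [Sum.elim_inl, monomial_single_add_single]
        simp [axisPowers, symmetricGenerators, mul_pow, ← pow_mul]
      · rw [Sum.elim_inr, monomial_single_add_single]
        simp only [axisPowers, symmetricGenerators, Sum.elim_inr, map_pow, aeval_X, mul_pow,
          ← pow_mul, Matrix.cons_val]

/-- If `b ≥ a + 2`, then `z₁ ^ (a + 1) z₃ ^ (b - a - 1) - z₀ z₂ ^ (b - 1)` is a further relation.
Setting `z₁ = z₃ = 0`, `z₀ = x`, `z₂ = y` sends it to `-x y ^ (b - 1)`, but the three generators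
into `(x ^ 2, y ^ b)`. -/
theorem eq_add_one_of_symmetricDefiningIdeal_eq_span (hab : a < b) (hc : a + b = c)
    (h : symmetricDefiningIdeal K a b c = Ideal.span (Set.range ![X 1 * X 2 - X 0 * X 3,
      X 1 ^ b - X 0 ^ (b - a) * X 2 ^ a, X 2 ^ b - X 3 ^ (b - a) * X 1 ^ a])) : b = a + 1 := by
  by_contra hne
  obtain ⟨d, rfl⟩ : ∃ d, b = a + 2 + d := Nat.exists_eq_add_of_le (by omega)
  have hmem := quadMonomial_sub_mem_symmetricDefiningIdeal (K := K) (a := a) (b := a + 2 + d)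
    (c := c) (m₀ := 0) (m₁ := a + 1) (m₂ := 0) (m₃ := d + 1) (n₀ := 1) (n₁ := 0)
    (n₂ := a + 1 + d) (n₃ := 0) (by omega) (by rw [← hc]; ring) (by rw [← hc]; ring)
  rw [h] at hmem
  let ε : MvPolynomial (Fin 4) K →ₐ[K] MvPolynomial (Fin 2) K := aeval ![X 0, 0, X 1, 0]
  let T : Set (Fin 2 →₀ ℕ) := {Finsupp.single 0 2, Finsupp.single 1 (a + 2 + d)}
  have hle : Ideal.span (Set.range ![X 1 * X 2 - X 0 * X 3,
      X 1 ^ (a + 2 + d) - X 0 ^ (a + 2 + d - a) * X 2 ^ a,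
      X 2 ^ (a + 2 + d) - X 3 ^ (a + 2 + d - a) * X 1 ^ a]) ≤
      (Ideal.span ((fun s ↦ monomial s (1 : K)) '' T)).comap ε := by
    refine Ideal.span_le.mpr ?_
    have hX : (X 0 ^ 2 : MvPolynomial (Fin 2) K) ∈
        Ideal.span ((fun s ↦ monomial s (1 : K)) '' T) :=
      Ideal.subset_span ⟨_, Or.inl rfl, by simp [X, monomial_pow]⟩
    have hY : (X 1 ^ (a + 2 + d) : MvPolynomial (Fin 2) K) ∈
        Ideal.span ((fun s ↦ monomial s (1 : K)) '' T) :=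
      Ideal.subset_span ⟨_, Or.inr rfl, by simp [X, monomial_pow]⟩
    have hd : a + 2 + d - a = 2 + d := by omega
    rintro _ ⟨i, rfl⟩
    change ε _ ∈ Ideal.span ((fun s ↦ monomial s (1 : K)) '' T)
    fin_cases i
    · simp [ε]
    · simp only [hd]
      have : ε (X 1 ^ (a + 2 + d) - X 0 ^ (2 + d) * X 2 ^ a) = -(X 0 ^ d * X 1 ^ a) * X 0 ^ 2 := by
        simp [ε]
        ring
      exact this ▸ Ideal.mul_mem_left _ _ hX
    · simp only [hd]
      have : ε (X 2 ^ (a + 2 + d) - X 3 ^ (2 + d) * X 1 ^ a) = X 1 ^ (a + 2 + d) := by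
        simp [ε]
      exact this ▸ hY
  have h1 : ε _ ∈ Ideal.span ((fun s ↦ monomial s (1 : K)) '' T) := hle hmem
  have h2 : ε (quadMonomial K 0 (a + 1) 0 (d + 1) - quadMonomial K 1 0 (a + 1 + d) 0) =
      monomial (Finsupp.single 0 1 + Finsupp.single 1 (a + 1 + d)) (-1) := by
    rw [map_neg, monomial_single_add_single]
    simp [ε, quadMonomial]
  rw [h2, mem_ideal_span_monomial_image] at h1
  obtain ⟨s, hs, hle⟩ := h1 (Finsupp.single 0 1 + Finsupp.single 1 (a + 1 + d))
    (by classical simp [mem_support_iff, coeff_monomial])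
  rcases hs with rfl | rfl
  · have := Finsupp.le_def.mp hle 0
    simp at this
  · have := Finsupp.le_def.mp hle 1
    simp at this

/-- If the generators of the ideal have the same degree, the conditions are equivalent. -/
theorem tfae_of_add_eq (ha : 0 < a) (hab : a < b) (hcop : Nat.Coprime a b) (hc : a + b = c)
    {F : Type*} [CommRing F] {φ : MvPolynomial (Fin 4) K →+* F} (hφ : Function.Surjective φ)
    (hker : RingHom.ker φ = symmetricDefiningIdeal K a b c) :
    List.TFAE [IsCohenMacaulay F, (symmetricDefiningIdeal K a b c).spanFinrank ≤ 3,
      (symmetricDefiningIdeal K a b c).spanFinrank = 3] := by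
  have hmid : ∀ g ∈ symmetricDefiningIdeal K a b c, ∀ m : Fin 4 →₀ ℕ, m 0 = 0 → m 3 = 0 →
      (m 1 < b ∧ m 2 = 0 ∨ m 1 = 0 ∧ m 2 < b) → coeff m g = 0 := by
    intro g hg m h0 h3 h
    refine coeff_eq_zero_of_mem_symmetricDefiningIdeal hg fun n₀ n₁ n₂ n₃ hn hx hy ↦ ?_
    rcases h with ⟨h1, h2⟩ | ⟨h1, h2⟩
    · simp only [h0, h2, h3, mul_zero, add_zero, zero_add] at hn hx hy ⊢
      exact eq_of_le_of_add_eq (by omega) hcop hc h1 hn hx hy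
    · simp only [h0, h1, h3, mul_zero, add_zero, zero_add] at hn hx hy ⊢
      have := eq_of_le_of_add_eq (by omega) hcop hc (n₀ := n₃) (n₁ := n₂) (n₂ := n₁) (n₃ := n₀) h2
        (by omega) (by omega) (by omega)
      tauto
  have hred : PlaneReduction (symmetricDefiningIdeal K a b c) b (X 0) (X 3)
      (aeval ![0, X 0, X 1, 0]) ![X 1 * X 2 - X 0 * X 3,
      X 1 ^ b - X 0 ^ (b - a) * X 2 ^ a, X 2 ^ b - X 3 ^ (b - a) * X 1 ^ a] := by
    obtain ⟨d, rfl⟩ := Nat.exists_eq_add_of_le hab.le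
    have hd : a + d - a = d := by omega
    have hd0 : d ≠ 0 := by omega
    refine planeReduction_of_coeff_eq_zero rfl rfl (fun i ↦ by fin_cases i <;> simp) (by omega)
      (isHomogeneous_X K 0) (isHomogeneous_X K 3) (by simp) (by simp) ?_ ?_ ?_
      (coeff_single_aeval_middle_eq_zero hmid)
    · intro i
      fin_cases i
      · have := quadMonomial_sub_mem_symmetricDefiningIdeal (K := K) (a := a) (b := a + d) (c := c)
          (n₀ := 1) (n₁ := 0) (n₂ := 0) (n₃ := 1) (m₀ := 0) (m₁ := 1) (m₂ := 1) (m₃ := 0)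
          rfl (by omega) (by omega)
        simpa [quadMonomial] using this
      · have := quadMonomial_sub_mem_symmetricDefiningIdeal (K := K) (a := a) (b := a + d) (c := c)
          (n₀ := d) (n₁ := 0) (n₂ := a) (n₃ := 0) (m₀ := 0) (m₁ := a + d) (m₂ := 0) (m₃ := 0)
          (by omega) (by rw [← hc]; ring) (by ring)
        simpa [quadMonomial] using this
      · have := quadMonomial_sub_mem_symmetricDefiningIdeal (K := K) (a := a) (b := a + d) (c := c)
          (n₀ := 0) (n₁ := a) (n₂ := 0) (n₃ := d) (m₀ := 0) (m₁ := 0) (m₂ := a + d) (m₃ := 0)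
          (by omega) (by ring) (by rw [← hc]; ring)
        simpa [quadMonomial, mul_comm] using this
    · intro i
      simp only [hd]
      fin_cases i
      · exact ⟨2, ((isHomogeneous_X K 1).mul (isHomogeneous_X K 2)).sub
          ((isHomogeneous_X K 0).mul (isHomogeneous_X K 3))⟩
      · refine ⟨a + d, (isHomogeneous_X_pow 1 (a + d)).sub ?_⟩
        rw [add_comm a d]
        exact (isHomogeneous_X_pow 0 d).mul (isHomogeneous_X_pow 2 a)
      · refine ⟨a + d, (isHomogeneous_X_pow 2 (a + d)).sub ?_⟩
        rw [add_comm a d]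
        exact (isHomogeneous_X_pow 3 d).mul (isHomogeneous_X_pow 1 a)
    · intro i
      fin_cases i <;> simp [planeGenerators, hd0]
  refine hred.tfae hφ hker (v := symmetricGenerators K a b c) (n := c) (fun i ↦ ?_) (by omega)
    (i := 0) (j := 3) rfl rfl (fun g hg ↦ aeval_eq_zero_of_mem_symmetricDefiningIdeal hc hg)
    fun hJ ↦ ?_
  · fin_cases i <;> simp [symmetricGenerators] <;> omega
  · obtain rfl := eq_add_one_of_symmetricDefiningIdeal_eq_span hab hc hJ
    obtain rfl : c = 2 * a + 1 := by omega
    exact isCohenMacaulay_of_ker_eq_symmetricDefiningIdeal ha hφ hker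

end ProjectiveCurve

theorem corollary3p5 {K : Type*} [Field K] (a b c : ℕ) (ha : 0 < a) (hab : a < b) (hbc : b < c)
    (hgcd : Nat.gcd (Nat.gcd a b) c = 1) :
    List.TFAE [
      IsCohenMacaulay (FiberCone (symmetricIdeal K a b c)),
      (fiberConeDefiningIdeal (symmetricGenerators K a b c)).spanFinrank ≤ 3,
      (fiberConeDefiningIdeal (symmetricGenerators K a b c)).spanFinrank = 3] := by
  have hsurj := fiberConeMap_surjective (symmetricGenerators K a b c)
  unfold symmetricIdeal
  rcases lt_trichotomy c (a + b) with h | h | h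
  · exact tfae_of_lt_add hab hbc h (φ := (fiberConeMap _).toRingHom) hsurj rfl
  · have hcop : Nat.Coprime a b := by
      have hdvd : a.gcd b ∣ c := h ▸ dvd_add (Nat.gcd_dvd_left a b) (Nat.gcd_dvd_right a b)
      rwa [Nat.gcd_eq_left hdvd] at hgcd
    exact tfae_of_add_eq ha hab hcop h.symm (φ := (fiberConeMap _).toRingHom) hsurj rfl
  · exact tfae_of_add_lt ha hab hbc h (φ := (fiberConeMap _).toRingHom) hsurj rfl
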